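/- **Setting.** Let $\mathfrak g$ be the Kac–Moody Lie algebra over $\mathbb C$ attached to a realization of a generalized Cartan matrix, with Cartan subalgebra $\mathfrak h$. Put $\mathfrak g'=[\mathfrak g,\mathfrak g]$ and $\mathfrak h'=\mathfrak h\cap\mathfrak g'$, let $\mathfrak h''$ be a complement of $\mathfrak h'$ in $\mathfrak h$, and let $N^+$ be the sum of the positive root spaces. Let $A$ be a finitely generated commutative associative unital $\mathbb C$-algebra. For such an algebra $B$ (here $B=A$ or a quotient of $A$) let $\mathfrak g_B=(\mathfrak g'\otimes B)\oplus\mathfrak h''$ be the Lie algebra with $[X\otimes a,Y\otimes b]=[X,Y]\otimes ab$, $[h,X\otimes a]=[h,X]\otimes a$ and $[h,k]=0$ for $X,Y\in\mathfrak g'$, $a,b\in B$, $h,k\in\mathfrak h''$. Let $\psi:(\mathfrak h'\otimes A)\oplus\mathfrak h''\to\mathbb C$ be linear and let $V(\psi)$ be an irreducible $\mathfrak g_A$-module of highest weight $\psi$; that is, it is generated by a nonzero vector $v$ with $(N^+\otimes A)v=0$ and $h v=\psi(h)v$ for all $h\in(\mathfrak h'\otimes A)\oplus\mathfrak h''$.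 For $\mu\in\mathfrak h^*$ let $V_\mu$ be the space of vectors on which every $h\in\mathfrak h=(\mathfrak h'\otimes 1)\oplus\mathfrak h''$ acts by $\mu(h)$. Assume that $V(\psi)$ is integrable, i.e. $V(\psi)=\bigoplus_{\mu\in\mathfrak h^*}V_\mu$ and, for every real root $\alpha$, every root vector $X_\alpha\in\mathfrak g_\alpha$, every $a\in A$ and every $w\in V(\psi)$, some power of $X_\alpha\otimes a$ kills $w$. Assume also that all weight spaces $V_\mu$ are finite-dimensional. **Theorem 3.3.** There is an ideal $I$ of $A$ that is cofinite (i.e. $\dim_{\mathbb C}A/I<\infty$) and satisfies $\psi(\mathfrak h'\otimes I)=0$. For every such $I$, the ideal $J=\sqrt I$ is a cofinite radical ideal with the following properties. 1. $\mathfrak g'\otimes J$ acts as zero on $V(\psi)$, and the action of $\mathfrak g_A$ on $V(\psi)$ factors through $\mathfrak g_A\to\mathfrak g_{A/J}$, so $V(\psi)$ is a module for $(\mathfrak g'\otimes A/J)\oplus\mathfrak h''$. 2. There are an integer $k\ge 0$ and pairwise distinct algebra homomorphisms $\chi_1,\dots,\chi_k:A\to\mathbb C$ with $J=\bigcap_{i=1}^k\ker\chi_i$.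 The assignment $X\otimes(a+J)+h\mapsto(\chi_1(a)X,\dots,\chi_k(a)X)+h$ defines an isomorphism of Lie algebras $$(\mathfrak g'\otimes A/J)\oplus\mathfrak h''\;\cong\;\Big(\bigoplus_{k\text{ times}}\mathfrak g'\Big)\oplus\mathfrak h'',$$ where $\mathfrak h''$ acts on each copy of $\mathfrak g'$ by the adjoint action. Through it $V(\psi)$ is a module for $\big(\bigoplus_{k\text{ times}}\mathfrak g'\big)\oplus\mathfrak h''$, on which $(\chi_1(a)X,\dots,\chi_k(a)X)+h$ acts as $X\otimes a+h\in\mathfrak g_A$. -/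

import Mathlib

open scoped TensorProduct

namespace KacMoody

noncomputable section

/-- Generalized Cartan matrices. -/
structure IsGCM {ι : Type*} (C : Matrix ι ι ℤ) : Prop where
  diag : ∀ i, C i i = 2
  offDiag : ∀ i j, i ≠ j → C i j ≤ 0
  zero_symm : ∀ i j, C i j = 0 → C j i = 0

/-- A realization `(H, {α_i}, {α_i^∨})` of the matrix `C`: the simple roots and the simple coroots
are linearly independent, `⟨α_i^∨, α_j⟩ = C i j`, and `dim H = 2 n - rank C`. -/
structure Realization {ι : Type*} [Fintype ι] (C : Matrix ι ι ℤ)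
    (H : Type*) [AddCommGroup H] [Module ℂ H] where
  gcm : IsGCM C
  finiteDimensional : FiniteDimensional ℂ H
  root : ι → Module.Dual ℂ H
  coroot : ι → H
  linearIndependent_root : LinearIndependent ℂ root
  linearIndependent_coroot : LinearIndependent ℂ coroot
  root_coroot : ∀ i j, root j (coroot i) = (C i j : ℂ)
  finrank_add_rank :
    Module.finrank ℂ H + (C.map (fun z : ℤ => (z : ℂ))).rank = 2 * Fintype.card ι

/-- Generators `e_i`, `f_i` and the elements of the Cartan subalgebra. -/
inductive Gen (ι : Type*) (H : Type*)
  | e : ι → Gen ι H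
  | f : ι → Gen ι H
  | h : H → Gen ι H

/-- The generator `e_i` of the free Lie algebra. -/
abbrev Gen.freeE {ι : Type*} (H : Type*) (i : ι) : FreeLieAlgebra ℂ (Gen ι H) :=
  FreeLieAlgebra.of ℂ (Gen.e i)

/-- The generator `f_i` of the free Lie algebra. -/
abbrev Gen.freeF {ι : Type*} (H : Type*) (i : ι) : FreeLieAlgebra ℂ (Gen ι H) :=
  FreeLieAlgebra.of ℂ (Gen.f i)

/-- The generator `t` of the free Lie algebra, for `t ∈ H`. -/
abbrev Gen.freeH (ι : Type*) {H : Type*} (t : H) : FreeLieAlgebra ℂ (Gen ι H) :=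
  FreeLieAlgebra.of ℂ (Gen.h t)

/-- Every vector space regarded as an abelian Lie algebra. -/
def AbelianLie (T : Type*) : Type _ := T

namespace AbelianLie

variable (T : Type*) [AddCommGroup T] [Module ℂ T]

instance : AddCommGroup (AbelianLie T) := inferInstanceAs (AddCommGroup T)

instance : Module ℂ (AbelianLie T) := inferInstanceAs (Module ℂ T)

instance : LieRing (AbelianLie T) where
  bracket _ _ := 0
  add_lie _ _ _ := (add_zero _).symm
  lie_add _ _ _ := (add_zero _).symm
  lie_self _ := rfl
  leibniz_lie _ _ _ := (add_zero _).symm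

instance : LieAlgebra ℂ (AbelianLie T) where
  lie_smul c _ _ := (smul_zero c).symm

/-- The identity map from `T` to the abelian Lie algebra on `T`. -/
def of : T ≃ₗ[ℂ] AbelianLie T := LinearEquiv.refl ℂ T

end AbelianLie

/-- The direct sum of `k` copies of a Lie algebra, with the componentwise bracket. -/
instance piLieRing (k : ℕ) (L : Type*) [LieRing L] : LieRing (Fin k → L) where
  bracket x y i := ⁅x i, y i⁆
  add_lie _ _ _ := funext fun _ => add_lie _ _ _
  lie_add _ _ _ := funext fun _ => lie_add _ _ _
  lie_self _ := funext fun _ => lie_self _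
  leibniz_lie _ _ _ := funext fun _ => leibniz_lie _ _ _

instance piLieAlgebra (k : ℕ) (L : Type*) [LieRing L] [LieAlgebra ℂ L] :
    LieAlgebra ℂ (Fin k → L) where
  lie_smul _ _ _ := funext fun _ => lie_smul _ _ _

namespace Realization

variable {ι : Type*} [Fintype ι] {C : Matrix ι ι ℤ} {H : Type*} [AddCommGroup H] [Module ℂ H]

/-- The relators of the auxiliary Lie algebra `g̃`: the generators `h t` depend linearly on `t`,
`[t, t'] = 0`, `[t, e_i] = α_i(t) e_i`, `[t, f_i] = -α_i(t) f_i`, `[e_i, f_j] = δ_ij α_i^∨`. -/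
inductive IsRelator (R : Realization C H) : FreeLieAlgebra ℂ (Gen ι H) → Prop
  | add (s t : H) : IsRelator R (Gen.freeH ι (s + t) - (Gen.freeH ι s + Gen.freeH ι t))
  | smul (c : ℂ) (t : H) : IsRelator R (Gen.freeH ι (c • t) - c • Gen.freeH ι t)
  | hh (s t : H) : IsRelator R ⁅Gen.freeH ι s, Gen.freeH ι t⁆
  | he (t : H) (i : ι) :
      IsRelator R (⁅Gen.freeH ι t, Gen.freeE H i⁆ - R.root i t • Gen.freeE H i)
  | hf (t : H) (i : ι) :
      IsRelator R (⁅Gen.freeH ι t, Gen.freeF H i⁆ + R.root i t • Gen.freeF H i)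
  | ef (i : ι) : IsRelator R (⁅Gen.freeE H i, Gen.freeF H i⁆ - Gen.freeH ι (R.coroot i))
  | ef_ne (i j : ι) (hij : i ≠ j) : IsRelator R ⁅Gen.freeE H i, Gen.freeF H j⁆

/-- The ideal generated by the relators. -/
def relatorIdeal (R : Realization C H) : LieIdeal ℂ (FreeLieAlgebra ℂ (Gen ι H)) :=
  LieSubmodule.lieSpan ℂ _ {x | R.IsRelator x}

/-- The auxiliary Lie algebra `g̃`. -/
def Aux (R : Realization C H) : Type _ := FreeLieAlgebra ℂ (Gen ι H) ⧸ R.relatorIdeal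

instance (R : Realization C H) : LieRing R.Aux :=
  inferInstanceAs (LieRing (FreeLieAlgebra ℂ (Gen ι H) ⧸ R.relatorIdeal))

instance (R : Realization C H) : LieAlgebra ℂ R.Aux :=
  inferInstanceAs (LieAlgebra ℂ (FreeLieAlgebra ℂ (Gen ι H) ⧸ R.relatorIdeal))

/-- The image in `g̃` of a generator. -/
def auxGen (R : Realization C H) (x : Gen ι H) : R.Aux :=
  LieSubmodule.Quotient.mk (N := R.relatorIdeal) (FreeLieAlgebra.of ℂ x)

/-- The largest ideal of `g̃` that meets the Cartan subalgebra trivially, as the sum of all the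
ideals with this property. -/
def maxIdeal (R : Realization C H) : LieIdeal ℂ R.Aux :=
  sSup {I | ∀ t : H, R.auxGen (Gen.h t) ∈ I → R.auxGen (Gen.h t) = 0}

/-- The Kac-Moody algebra `g` of the realization. -/
def Alg (R : Realization C H) : Type _ := R.Aux ⧸ R.maxIdeal

instance (R : Realization C H) : LieRing R.Alg :=
  inferInstanceAs (LieRing (R.Aux ⧸ R.maxIdeal))

instance (R : Realization C H) : LieAlgebra ℂ R.Alg :=
  inferInstanceAs (LieAlgebra ℂ (R.Aux ⧸ R.maxIdeal))

/-- The image in `g` of a generator. -/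
def gen (R : Realization C H) (x : Gen ι H) : R.Alg :=
  LieSubmodule.Quotient.mk (N := R.maxIdeal) (R.auxGen x)

/-- The embedding of the Cartan subalgebra `H` into `g`. -/
def cartan (R : Realization C H) : H →ₗ[ℂ] R.Alg where
  toFun t := R.gen (Gen.h t)
  map_add' s t := by
    have h : R.auxGen (Gen.h (s + t)) = R.auxGen (Gen.h s) + R.auxGen (Gen.h t) := by
      refine (Submodule.Quotient.eq R.relatorIdeal.toSubmodule).2 ?_
      exact LieSubmodule.subset_lieSpan (IsRelator.add (R := R) s t)
    exact congrArg (LieSubmodule.Quotient.mk (N := R.maxIdeal)) h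
  map_smul' c t := by
    have h : R.auxGen (Gen.h (c • t)) = c • R.auxGen (Gen.h t) := by
      refine (Submodule.Quotient.eq R.relatorIdeal.toSubmodule).2 ?_
      exact LieSubmodule.subset_lieSpan (IsRelator.smul (R := R) c t)
    exact congrArg (LieSubmodule.Quotient.mk (N := R.maxIdeal)) h

theorem cartan_lie_cartan (R : Realization C H) (s t : H) : ⁅R.cartan s, R.cartan t⁆ = 0 := by
  have h : ⁅R.auxGen (Gen.h s), R.auxGen (Gen.h t)⁆ = 0 :=
    (LieSubmodule.Quotient.mk_eq_zero' (N := R.relatorIdeal)).2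
      (LieSubmodule.subset_lieSpan (IsRelator.hh (R := R) s t))
  exact congrArg (LieSubmodule.Quotient.mk (N := R.maxIdeal)) h

/-- The derived algebra `g' = [g, g]`. -/
def derived (R : Realization C H) : LieIdeal ℂ R.Alg :=
  ⁅(⊤ : LieIdeal ℂ R.Alg), (⊤ : LieIdeal ℂ R.Alg)⁆

/-- `h' = h ∩ g'`, as a subspace of `H`. -/
def cartan' (R : Realization C H) : Submodule ℂ H :=
  R.derived.toSubmodule.comap R.cartan

/-- The inclusion of `h'` in `g'`. -/
def cartanToDerived (R : Realization C H) : R.cartan' →ₗ[ℂ] R.derived :=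
  R.cartan.restrict (p := R.cartan') (q := R.derived.toSubmodule) fun _ ht => ht

/-- The root space `g_α`. -/
def rootSpace (R : Realization C H) (α : Module.Dual ℂ H) : Submodule ℂ R.Alg where
  carrier := {x | ∀ t : H, ⁅R.cartan t, x⁆ = α t • x}
  add_mem' hx hy t := by rw [lie_add, hx t, hy t, smul_add]
  zero_mem' t := by rw [lie_zero, smul_zero]
  smul_mem' c x hx t := by rw [lie_smul, hx t, smul_comm]

/-- Positive roots. -/
def IsPosRoot (R : Realization C H) (α : Module.Dual ℂ H) : Prop :=
  α ≠ 0 ∧ R.rootSpace α ≠ ⊥ ∧ ∃ n : ι → ℕ, α = ∑ i, n i • R.root i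

/-- `N⁺`, the sum of the positive root spaces. -/
def nPos (R : Realization C H) : Submodule ℂ R.Alg :=
  ⨆ (α : Module.Dual ℂ H) (_ : R.IsPosRoot α), R.rootSpace α

theorem eval_coroot_root (R : Realization C H) (i : ι) :
    Module.Dual.eval ℂ H (R.coroot i) (R.root i) = 2 := by
  rw [Module.Dual.eval_apply, R.root_coroot, R.gcm.diag]
  norm_num

/-- The Weyl group, acting on the dual of the Cartan subalgebra. -/
def weylGroup (R : Realization C H) : Subgroup (Module.Dual ℂ H ≃ₗ[ℂ] Module.Dual ℂ H) :=
  Subgroup.closure (Set.range fun i => Module.reflection (R.eval_coroot_root i))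

/-- Real roots: the images of the simple roots under the Weyl group. -/
def IsRealRoot (R : Realization C H) (α : Module.Dual ℂ H) : Prop :=
  ∃ w ∈ R.weylGroup, ∃ i, α = w (R.root i)

/-- The derivation `ad t` of `g'`, for `t` in the Cartan subalgebra. -/
def adCartan (R : Realization C H) (t : H) : LieDerivation ℂ R.derived R.derived where
  toLinearMap := LieModule.toEnd ℂ R.Alg R.derived (R.cartan t)
  leibniz' x y := by
    apply Subtype.ext
    change ⁅R.cartan t, ⁅(x : R.Alg), (y : R.Alg)⁆⁆ =
      ⁅(x : R.Alg), ⁅R.cartan t, (y : R.Alg)⁆⁆ - ⁅(y : R.Alg), ⁅R.cartan t, (x : R.Alg)⁆⁆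
    rw [leibniz_lie, ← lie_skew (y : R.Alg) ⁅R.cartan t, (x : R.Alg)⁆]
    abel

theorem adCartan_comm (R : Realization C H) (s t : H) (x : R.derived) :
    R.adCartan s (R.adCartan t x) = R.adCartan t (R.adCartan s x) := by
  apply Subtype.ext
  change ⁅R.cartan s, ⁅R.cartan t, (x : R.Alg)⁆⁆ = ⁅R.cartan t, ⁅R.cartan s, (x : R.Alg)⁆⁆
  rw [leibniz_lie, R.cartan_lie_cartan, zero_lie, zero_add]

theorem adCartan_add (R : Realization C H) (s t : H) (x : R.derived) :
    R.adCartan (s + t) x = R.adCartan s x + R.adCartan t x := by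
  apply Subtype.ext
  change ⁅R.cartan (s + t), (x : R.Alg)⁆ = ⁅R.cartan s, (x : R.Alg)⁆ + ⁅R.cartan t, (x : R.Alg)⁆
  rw [map_add, add_lie]

theorem adCartan_smul (R : Realization C H) (c : ℂ) (t : H) (x : R.derived) :
    R.adCartan (c • t) x = c • R.adCartan t x := by
  apply Subtype.ext
  change ⁅R.cartan (c • t), (x : R.Alg)⁆ = c • ⁅R.cartan t, (x : R.Alg)⁆
  rw [map_smul, smul_lie]

theorem adCartan_zero (R : Realization C H) (x : R.derived) : R.adCartan 0 x = 0 := by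
  have h := R.adCartan_smul 0 0 x
  rwa [zero_smul, zero_smul] at h

/-- The derivation `id ⊗ ad t` of `A ⊗ g'`. -/
def adTensor (R : Realization C H) (A : Type*) [CommRing A] [Algebra ℂ A] (t : H) :
    LieDerivation ℂ (A ⊗[ℂ] R.derived) (A ⊗[ℂ] R.derived) where
  toLinearMap := LinearMap.lTensor A (R.adCartan t : R.derived →ₗ[ℂ] R.derived)
  leibniz' x y := by
    induction x using TensorProduct.induction_on with
    | zero => simp
    | add x₁ x₂ h₁ h₂ => simp only [add_lie, lie_add, map_add, h₁, h₂]; abel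
    | tmul a x =>
      induction y using TensorProduct.induction_on with
      | zero => simp
      | add y₁ y₂ h₁ h₂ => simp only [add_lie, lie_add, map_add, h₁, h₂]; abel
      | tmul b y =>
        simp only [LieAlgebra.ExtendScalars.bracket_tmul, LinearMap.lTensor_tmul,
          LieDerivation.coeFn_coe, LieDerivation.apply_lie_eq_sub, TensorProduct.tmul_sub,
          mul_comm b a]

theorem adTensor_tmul (R : Realization C H) (A : Type*) [CommRing A] [Algebra ℂ A] (t : H) (a : A)
    (x : R.derived) : R.adTensor A t (a ⊗ₜ x) = a ⊗ₜ R.adCartan t x := rfl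

/-- The action of the complement `h''` on `A ⊗ g'`. -/
def complAct (R : Realization C H) (S : Submodule ℂ H) (A : Type*) [CommRing A] [Algebra ℂ A] :
    AbelianLie S →ₗ⁅ℂ⁆ LieDerivation ℂ (A ⊗[ℂ] R.derived) (A ⊗[ℂ] R.derived) where
  toFun t := R.adTensor A ((AbelianLie.of S).symm t : H)
  map_add' s t := by
    ext y
    induction y using TensorProduct.induction_on with
    | zero => simp
    | add y₁ y₂ h₁ h₂ => rw [map_add, h₁, h₂, map_add]
    | tmul a x =>
      simp only [LieDerivation.add_apply, adTensor_tmul, map_add, Submodule.coe_add, adCartan_add,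
        TensorProduct.tmul_add]
  map_smul' c t := by
    ext y
    induction y using TensorProduct.induction_on with
    | zero => simp
    | add y₁ y₂ h₁ h₂ => rw [map_add, h₁, h₂, map_add]
    | tmul a x =>
      simp only [LieDerivation.smul_apply, adTensor_tmul, map_smul, Submodule.coe_smul,
        adCartan_smul, TensorProduct.tmul_smul, RingHom.id_apply]
  map_lie' {s t} := by
    ext y
    induction y using TensorProduct.induction_on with
    | zero => simp
    | add y₁ y₂ h₁ h₂ => simp only [map_add] at h₁ h₂ ⊢; rw [h₁, h₂]
    | tmul a x =>
      have h : (((AbelianLie.of S).symm ⁅s, t⁆ : S) : H) = 0 := rfl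
      rw [LieDerivation.lie_apply, h]
      simp only [adTensor_tmul]
      rw [adCartan_comm, sub_self, adCartan_zero, TensorProduct.tmul_zero]

/-- The current Kac-Moody algebra `g_A = (g' ⊗ A) ⊕ h''`, with
`[X ⊗ a, Y ⊗ b] = [X, Y] ⊗ ab`, `[h, X ⊗ a] = [h, X] ⊗ a` and `[h, k] = 0` for `h, k ∈ h''`. -/
abbrev Current (R : Realization C H) (S : Submodule ℂ H) (A : Type*) [CommRing A] [Algebra ℂ A] :
    Type _ :=
  LieAlgebra.SemiDirectSum (A ⊗[ℂ] R.derived) (AbelianLie S) (R.complAct S A)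

/-- The element `y + t` of `g_A`, for `y ∈ g' ⊗ A` and `t ∈ h''`. -/
abbrev Current.mk (R : Realization C H) (S : Submodule ℂ H) {A : Type*} [CommRing A] [Algebra ℂ A]
    (y : A ⊗[ℂ] R.derived) (t : S) : R.Current S A :=
  ⟨y, AbelianLie.of S t⟩

/-- The diagonal action of the complement `h''` on the direct sum of `k` copies of `g'`. -/
def complActCopies (R : Realization C H) (S : Submodule ℂ H) (k : ℕ) :
    AbelianLie S →ₗ⁅ℂ⁆ LieDerivation ℂ (Fin k → R.derived) (Fin k → R.derived) where
  toFun t :=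
    { toFun := fun x i => R.adCartan ((AbelianLie.of S).symm t : H) (x i)
      map_add' := fun x y => by ext1 i; simp
      map_smul' := fun c x => by ext1 i; simp
      leibniz' := fun x y => by
        ext1 i
        exact (R.adCartan ((AbelianLie.of S).symm t : H)).leibniz' (x i) (y i) }
  map_add' s t := by
    ext1 x; ext1 i
    exact R.adCartan_add _ _ (x i)
  map_smul' c t := by
    ext1 x; ext1 i
    exact R.adCartan_smul c _ (x i)
  map_lie' {s t} := by
    ext1 x; ext1 i
    rw [LieDerivation.lie_apply]
    refine Eq.trans (R.adCartan_zero (x i)) ?_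
    exact (sub_eq_zero.2 (R.adCartan_comm _ _ (x i))).symm

/-- The Lie algebra `(g' ⊕ ⋯ ⊕ g') ⊕ h''` with `k` copies of `g'`, on each of which `h''` acts by
the adjoint action. -/
abbrev Copies (R : Realization C H) (S : Submodule ℂ H) (k : ℕ) : Type _ :=
  LieAlgebra.SemiDirectSum (Fin k → R.derived) (AbelianLie S) (R.complActCopies S k)

/-- The element `(x_1, …, x_k) + t` of `(g' ⊕ ⋯ ⊕ g') ⊕ h''`. -/
abbrev Copies.mk (R : Realization C H) (S : Submodule ℂ H) {k : ℕ}
    (x : Fin k → R.derived) (t : S) : R.Copies S k :=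
  ⟨x, AbelianLie.of S t⟩

section Modules

variable (R : Realization C H) (S : Submodule ℂ H) (A : Type*) [CommRing A] [Algebra ℂ A]
  (V : Type*) [AddCommGroup V] [Module ℂ V] [LieRingModule (R.Current S A) V]
  [LieModule ℂ (R.Current S A) V]

/-- `V` is a highest weight module of highest weight `ψ : (h' ⊗ A) ⊕ h'' → ℂ`. -/
def IsHighestWeight (ψ : (A ⊗[ℂ] R.cartan') × S →ₗ[ℂ] ℂ) : Prop :=
  ∃ v : V, v ≠ 0 ∧
    LieSubmodule.lieSpan ℂ (R.Current S A) {v} = ⊤ ∧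
    (∀ (a : A) (x : R.derived), (x : R.Alg) ∈ R.nPos →
      ⁅Current.mk R S (a ⊗ₜ[ℂ] x) 0, v⁆ = 0) ∧
    (∀ (y : A ⊗[ℂ] R.cartan') (t : S),
      ⁅Current.mk R S (LinearMap.lTensor A R.cartanToDerived y) t, v⁆ = ψ (y, t) • v)

/-- The weight space `V_μ`, for `μ` in the dual of `h = h' ⊕ h''`, where `h'` acts through
`h' ⊗ 1`. -/
def weightSpace (μ : Module.Dual ℂ H) : Submodule ℂ V where
  carrier := {v | ∀ (s : R.cartan') (t : S),
    ⁅Current.mk R S ((1 : A) ⊗ₜ[ℂ] R.cartanToDerived s) t, v⁆ = μ (s + t) • v}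
  add_mem' hx hy s t := by rw [lie_add, hx s t, hy s t, smul_add]
  zero_mem' s t := by rw [lie_zero, smul_zero]
  smul_mem' c x hx s t := by rw [lie_smul, hx s t, smul_comm]

open Classical in
/-- `V` is integrable: it is the direct sum of its weight spaces, and real root vectors act locally
nilpotently. -/
def IsIntegrable : Prop :=
  DirectSum.IsInternal (fun μ : Module.Dual ℂ H => R.weightSpace S A V μ) ∧
  ∀ α : Module.Dual ℂ H, R.IsRealRoot α → ∀ x : R.derived, (x : R.Alg) ∈ R.rootSpace α →
    ∀ (a : A) (v : V), ∃ k : ℕ,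
      ((LieModule.toEnd ℂ (R.Current S A) V (Current.mk R S (a ⊗ₜ[ℂ] x) 0)) ^ k) v = 0

/-- All weight spaces of `V` are finite-dimensional. -/
def HasFiniteWeightSpaces : Prop :=
  ∀ μ : Module.Dual ℂ H, FiniteDimensional ℂ (R.weightSpace S A V μ)

end Modules

end Realization

/-- An ideal of finite codimension. -/
def IsCofinite {A : Type*} [CommRing A] [Algebra ℂ A] (I : Ideal A) : Prop :=
  FiniteDimensional ℂ (A ⧸ I)

end

end KacMoody

/-!
Write `x ⊗ a` for the elements of `g' ⊗ A` and let `K` be the largest ideal of `A` such that `ψ`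
vanishes on `h' ⊗ K`. Every ideal `I` with `ψ (h' ⊗ I) = 0` is contained in `K`, so everything
follows once `K` is shown to be cofinite, to be radical and to annihilate the module.

* `K` annihilates the module: no nonzero subspace of an irreducible highest weight module that lies
  in degrees strictly below the highest weight vector `v` is stable under `n₊ ⊗ A`. For `a ∈ K`,
  applying `e_j ⊗ b` to the vectors `(f_i ⊗ a) v` only produces multiples of `ψ (α_i^∨ ⊗ ab) v = 0`,
  so these vectors vanish.
* `K` is cofinite: it is cut out by the vectors `(f_i ⊗ a) v`, which lie in the finitely many
  finite-dimensional weight spaces of weight `λ - α_i`.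
* `K` is radical: if `a ^ 2 ∈ K`, then `α_i^∨ ⊗ a = [e_i ⊗ 1, f_i ⊗ a]` commutes with the locally
  nilpotent operator `f_i ⊗ a`. With `e = e_i ⊗ 1`, `f = f_i ⊗ a` and `c = ψ (α_i^∨ ⊗ a)`, the
  Heisenberg relation gives `e f ^ (n + 1) v = (n + 1) c f ^ n v`, so `f ^ n v ≠ 0` for all `n`
  unless `c = 0`.

Finally `A / √I` is a reduced finite-dimensional algebra, hence a product of copies of `ℂ`.
-/

namespace KacMoody

noncomputable section

open scoped Pointwise ComplexOrder

section Eigenspan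

variable {K U V W : Type*} [Field K] [AddCommGroup U] [Module K U] [AddCommGroup V] [Module K V]
  [AddCommGroup W] [Module K W]

/-- The sum of the eigenspaces of `T` with eigenvalue in `B`, used to bound the degrees of the
vectors of a module graded by `T`. -/
def eigenspan (T : Module.End K V) (B : Set K) : Submodule K V := ⨆ c ∈ B, T.eigenspace c

variable {T : Module.End K V}

theorem mem_eigenspan {B : Set K} {c : K} (hc : c ∈ B) {x : V} (hx : T x = c • x) :
    x ∈ eigenspan T B :=
  le_biSup T.eigenspace hc (Module.End.mem_eigenspace_iff.2 hx)

theorem mem_eigenspan_singleton {c : K} {x : V} : x ∈ eigenspan T {c} ↔ T x = c • x := by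
  rw [eigenspan, iSup_singleton, Module.End.mem_eigenspace_iff]

theorem eigenspan_mono {B B' : Set K} (h : B ⊆ B') : eigenspan T B ≤ eigenspan T B' :=
  biSup_mono fun _ hc => h hc

theorem disjoint_eigenspan {B B' : Set K} (h : Disjoint B B') :
    Disjoint (eigenspan T B) (eigenspan T B') :=
  T.eigenspaces_iSupIndep.disjoint_biSup_biSup h

theorem apply_apply_mem_eigenspan_add {T₁ : Module.End K U} {T₂ : Module.End K V}
    {T₃ : Module.End K W} (β : U →ₗ[K] V →ₗ[K] W)
    (hβ : ∀ x y, T₃ (β x y) = β (T₁ x) y + β x (T₂ y)) {B₁ B₂ : Set K} {x : U} {y : V}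
    (hx : x ∈ eigenspan T₁ B₁) (hy : y ∈ eigenspan T₂ B₂) : β x y ∈ eigenspan T₃ (B₁ + B₂) := by
  suffices h : eigenspan T₁ B₁ ≤ (eigenspan T₃ (B₁ + B₂)).comap (β.flip y) from h hx
  refine iSup₂_le fun a ha x hxa => ?_
  suffices h : eigenspan T₂ B₂ ≤ (eigenspan T₃ (B₁ + B₂)).comap (β x) from h hy
  refine iSup₂_le fun b hb y hyb => mem_eigenspan (Set.add_mem_add ha hb) ?_
  rw [Module.End.mem_eigenspace_iff] at hxa hyb
  rw [hβ, hxa, hyb, map_smul, map_smul, LinearMap.smul_apply, add_smul]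

theorem apply_mem_eigenspan_of_commute {T' : Module.End K V} (h : Commute T T') {B : Set K}
    {x : V} (hx : x ∈ eigenspan T B) : T' x ∈ eigenspan T B := by
  suffices hle : eigenspan T B ≤ (eigenspan T B).comap T' from hle hx
  refine iSup₂_le fun c hc y hy => mem_eigenspan hc ?_
  rw [← Module.End.mul_apply, h.eq, Module.End.mul_apply, Module.End.mem_eigenspace_iff.1 hy,
    map_smul]

end Eigenspan

theorem finite_of_ker_le_ker {K U V W : Type*} [Field K] [AddCommGroup U] [Module K U]
    [AddCommGroup V] [Module K V] [AddCommGroup W] [Module K W] [Module.Finite K V]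
    {g : U →ₗ[K] V} {p : U →ₗ[K] W} (hp : Function.Surjective p)
    (h : LinearMap.ker g ≤ LinearMap.ker p) : Module.Finite K W :=
  have : Module.Finite K (U ⧸ LinearMap.ker g) := Module.Finite.equiv g.quotKerEquivRange.symm
  Module.Finite.of_surjective ((LinearMap.ker g).liftQ p h) fun w => by
    obtain ⟨u, rfl⟩ := hp w
    exact ⟨Submodule.Quotient.mk u, rfl⟩

section StableCore

variable {κ K V : Type*} [CommRing K] [AddCommGroup V] [Module K V] {E : κ → Module.End K V}
  {P : Submodule K V}

/-- The largest subspace of `P` stable under all the endomorphisms `E k`. -/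
def stableCore (E : κ → Module.End K V) (P : Submodule K V) : Submodule K V :=
  sSup {Q | Q ≤ P ∧ ∀ k, ∀ w ∈ Q, E k w ∈ Q}

theorem stableCore_le : stableCore E P ≤ P :=
  sSup_le fun _ hQ => hQ.1

theorem le_stableCore {Q : Submodule K V} (hQ : Q ≤ P) (h : ∀ k, ∀ w ∈ Q, E k w ∈ Q) :
    Q ≤ stableCore E P :=
  le_sSup ⟨hQ, h⟩

theorem apply_mem_stableCore (k : κ) {w : V} (hw : w ∈ stableCore E P) :
    E k w ∈ stableCore E P := by
  suffices h : stableCore E P ≤ (stableCore E P).comap (E k) from h hw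
  exact sSup_le fun Q hQ w hw => le_stableCore hQ.1 hQ.2 (hQ.2 k w hw)

theorem apply_mem_stableCore_of_commutator {T : Module.End K V} (hP : ∀ w ∈ P, T w ∈ P)
    (hT : ∀ k, ∀ w ∈ stableCore E P, E k (T w) - T (E k w) ∈ stableCore E P) {w : V}
    (hw : w ∈ stableCore E P) : T w ∈ stableCore E P := by
  suffices h : stableCore E P ⊔ (stableCore E P).map T ≤ stableCore E P from
    h (Submodule.mem_sup_right ⟨w, hw, rfl⟩)
  refine le_stableCore (sup_le stableCore_le ?_) fun k u hu => ?_
  · rintro _ ⟨u, hu, rfl⟩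
    exact hP u (stableCore_le hu)
  · obtain ⟨x, hx, _, ⟨y, hy, rfl⟩, rfl⟩ := Submodule.mem_sup.1 hu
    rw [map_add, ← sub_add_cancel (E k (T y)) (T (E k y))]
    exact add_mem (Submodule.mem_sup_left (apply_mem_stableCore k hx))
      (add_mem (Submodule.mem_sup_left (hT k y hy))
        (Submodule.mem_sup_right ⟨_, apply_mem_stableCore k hy, rfl⟩))

end StableCore

section LieModule

variable {K L V : Type*} [CommRing K] [LieRing L] [LieAlgebra K L] [AddCommGroup V] [Module K V]
  [LieRingModule L V] [LieModule K L V]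

/-- The elements of `L` that map `P` into its subspace `Q`. For `P = Q` this is the stabilizer of
`P`. -/
def transporter {P Q : Submodule K V} (h : Q ≤ P) : LieSubalgebra K L where
  carrier := {x | ∀ w ∈ P, ⁅x, w⁆ ∈ Q}
  add_mem' hx hy w hw := by rw [add_lie]; exact Q.add_mem (hx w hw) (hy w hw)
  zero_mem' w _ := by rw [zero_lie]; exact Q.zero_mem
  smul_mem' c x hx w hw := by rw [smul_lie]; exact Q.smul_mem c (hx w hw)
  lie_mem' hx hy w hw := by
    rw [lie_lie]
    exact Q.sub_mem (hx _ (h (hy w hw))) (hy _ (h (hx w hw)))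

end LieModule

section LieSpan

open LieSubalgebra

variable {K L : Type*} [CommRing K] [LieRing L] [LieAlgebra K L] {s : Set L} {T : Submodule K L}

theorem lie_mem_lieSpan {x : L} (h : ∀ y ∈ s, ⁅x, y⁆ ∈ lieSpan K L s) {y : L}
    (hy : y ∈ lieSpan K L s) : ⁅x, y⁆ ∈ lieSpan K L s := by
  induction hy using lieSpan_induction with
  | mem y hy => exact h y hy
  | zero => rw [lie_zero]; exact zero_mem _
  | add y z _ _ hy hz => rw [lie_add]; exact add_mem hy hz
  | smul c y _ hy => rw [lie_smul]; exact (lieSpan K L s).smul_mem c hy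
  | lie y z hy' hz' hy hz =>
    rw [leibniz_lie]
    exact add_mem (lie_mem _ hy hz') (lie_mem _ hy' hz)

theorem lie_mem_sup_lieSpan (hT : ∀ t ∈ T, ∀ y ∈ s, ⁅t, y⁆ ∈ lieSpan K L s) {x : L}
    (hx : ∀ y ∈ s, ⁅x, y⁆ ∈ T) {y : L} (hy : y ∈ lieSpan K L s) :
    ⁅x, y⁆ ∈ T ⊔ (lieSpan K L s).toSubmodule := by
  have hlie {u z : L} (hu : u ∈ T ⊔ (lieSpan K L s).toSubmodule) (hz : z ∈ lieSpan K L s) :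
      ⁅u, z⁆ ∈ T ⊔ (lieSpan K L s).toSubmodule := by
    obtain ⟨t, ht, n, hn, rfl⟩ := Submodule.mem_sup.1 hu
    rw [add_lie]
    exact Submodule.mem_sup_right (add_mem (lie_mem_lieSpan (hT t ht) hz) (lie_mem _ hn hz))
  induction hy using lieSpan_induction with
  | mem y hy => exact Submodule.mem_sup_left (hx y hy)
  | zero => rw [lie_zero]; exact zero_mem _
  | add y z _ _ hy hz => rw [lie_add]; exact add_mem hy hz
  | smul c y _ hy => rw [lie_smul]; exact Submodule.smul_mem _ c hy
  | lie y z hy' hz' hy hz =>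
    rw [leibniz_lie, ← lie_skew y]
    exact add_mem (hlie hy hz') (neg_mem (hlie hz hy'))

theorem lie_mem_triangular {p q : Set L} (hTp : ∀ t ∈ T, ∀ x ∈ p, ⁅t, x⁆ ∈ lieSpan K L p)
    (hTq : ∀ t ∈ T, ∀ y ∈ q, ⁅t, y⁆ ∈ lieSpan K L q) {x : L} (hx : x ∈ p)
    (hpq : ∀ y ∈ q, ⁅x, y⁆ ∈ T) {z : L}
    (hz : z ∈ T ⊔ (lieSpan K L p).toSubmodule ⊔ (lieSpan K L q).toSubmodule) :
    ⁅x, z⁆ ∈ T ⊔ (lieSpan K L p).toSubmodule ⊔ (lieSpan K L q).toSubmodule := by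
  obtain ⟨u, hu, n, hn, rfl⟩ := Submodule.mem_sup.1 hz
  obtain ⟨t, ht, m, hm, rfl⟩ := Submodule.mem_sup.1 hu
  have htm : ⁅x, t + m⁆ ∈ lieSpan K L p := by
    rw [lie_add, ← lie_skew]
    exact add_mem (neg_mem (hTp t ht x hx)) (lie_mem _ (subset_lieSpan hx) hm)
  rw [lie_add]
  exact add_mem (Submodule.mem_sup_left (Submodule.mem_sup_right htm))
    ((sup_le_sup_right le_sup_left _ : T ⊔ (lieSpan K L q).toSubmodule ≤ _)
      (lie_mem_sup_lieSpan hTq hpq hn))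

theorem triangular_eq_top {p q : Set L} (hTp : ∀ t ∈ T, ∀ x ∈ p, ⁅t, x⁆ ∈ lieSpan K L p)
    (hTq : ∀ t ∈ T, ∀ y ∈ q, ⁅t, y⁆ ∈ lieSpan K L q) (hpq : ∀ x ∈ p, ∀ y ∈ q, ⁅x, y⁆ ∈ T)
    (htop : lieSpan K L (p ∪ q) = ⊤) :
    T ⊔ (lieSpan K L p).toSubmodule ⊔ (lieSpan K L q).toSubmodule = ⊤ := by
  set M := T ⊔ (lieSpan K L p).toSubmodule ⊔ (lieSpan K L q).toSubmodule
  have hstab : lieSpan K L (p ∪ q) ≤ transporter (le_refl M) := by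
    refine lieSpan_le.2 (Set.union_subset (fun x hx z hz => ?_) fun y hy z hz => ?_)
    · exact lie_mem_triangular hTp hTq hx (hpq x hx) hz
    · have hqp : ∀ x ∈ p, ⁅y, x⁆ ∈ T := fun x hx => by
        rw [← lie_skew]
        exact neg_mem (hpq x hx y hy)
      rw [show M = _ from sup_right_comm ..] at hz ⊢
      exact lie_mem_triangular hTq hTp hy hqp hz
  let N : LieSubalgebra K L :=
    { M with lie_mem' := fun {x _} _ hy => (htop ▸ hstab) (mem_top x) _ hy }
  have hN : lieSpan K L (p ∪ q) ≤ N := lieSpan_le.2 (Set.union_subset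
    (fun x hx => Submodule.mem_sup_left (Submodule.mem_sup_right (subset_lieSpan hx)))
    fun y hy => Submodule.mem_sup_right (subset_lieSpan hy))
  exact eq_top_iff.2 fun x _ => hN (htop ▸ mem_top x)

theorem lie_mem_lieSpan_of_commuting (hTT : ∀ t ∈ T, ∀ u ∈ T, ⁅t, u⁆ = 0)
    (hTs : ∀ t ∈ T, ∀ x ∈ s, ⁅t, x⁆ ∈ lieSpan K L s) (htop : lieSpan K L (s ∪ T) = ⊤) (x y : L) :
    ⁅x, y⁆ ∈ lieSpan K L s := by
  set N := lieSpan K L s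
  have hTN : ∀ t ∈ T, ∀ n ∈ N, ⁅t, n⁆ ∈ N := fun t ht n hn => lie_mem_lieSpan (hTs t ht) hn
  have hNT : lieSpan K L (s ∪ T) ≤ transporter (le_sup_right : N.toSubmodule ≤ T ⊔ N) := by
    refine lieSpan_le.2 (Set.union_subset (fun x hx w hw => ?_) fun t ht w hw => ?_) <;>
      obtain ⟨u, hu, n, hn, rfl⟩ := Submodule.mem_sup.1 hw <;> rw [lie_add]
    · rw [← lie_skew]
      exact add_mem (neg_mem (hTs u hu x hx)) (lie_mem _ (subset_lieSpan hx) hn)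
    · rw [hTT t ht u hu, zero_add]
      exact hTN t ht n hn
  have hmem (w : L) (hw : w ∈ T ⊔ N.toSubmodule) (z : L) : ⁅w, z⁆ ∈ N := by
    rw [← lie_skew]
    exact neg_mem ((htop ▸ hNT) (mem_top z) w hw)
  have hall : lieSpan K L (s ∪ T) ≤ transporter (le_top : N.toSubmodule ≤ ⊤) :=
    lieSpan_le.2 (Set.union_subset
      (fun x hx z _ => hmem x (Submodule.mem_sup_right (subset_lieSpan hx)) z)
      fun t ht z _ => hmem t (Submodule.mem_sup_left ht) z)
  exact (htop ▸ hall) (mem_top x) y trivial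

theorem tmul_mem_of_mem_lieSpan {A : Type*} [CommRing A] [Algebra K A]
    {N : LieSubalgebra K (A ⊗[K] L)} (h : ∀ x ∈ s, ∀ a : A, a ⊗ₜ[K] x ∈ N) {x : L}
    (hx : x ∈ lieSpan K L s) (a : A) : a ⊗ₜ[K] x ∈ N := by
  induction hx using lieSpan_induction generalizing a with
  | mem x hx => exact h x hx a
  | zero => rw [TensorProduct.tmul_zero]; exact zero_mem N
  | add x y _ _ hx hy => rw [TensorProduct.tmul_add]; exact add_mem (hx a) (hy a)
  | smul c x _ hx => rw [TensorProduct.tmul_smul]; exact N.smul_mem c (hx a)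
  | lie x y _ _ hx hy =>
    rw [← mul_one a, ← LieAlgebra.ExtendScalars.bracket_tmul]
    exact N.lie_mem (hx a) (hy 1)

end LieSpan

theorem lieSpan_le_eigenspan {K L : Type*} [Field K] [LieRing L] [LieAlgebra K L]
    (D : LieDerivation K L L) {s : Set L} {B : Set K} (hB : B + B ⊆ B)
    (hs : s ⊆ eigenspan (D : L →ₗ[K] L) B) :
    (LieSubalgebra.lieSpan K L s).toSubmodule ≤ eigenspan (D : L →ₗ[K] L) B := by
  intro x hx
  induction hx using LieSubalgebra.lieSpan_induction with
  | mem x hx => exact hs hx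
  | zero => exact zero_mem _
  | add x y _ _ hx hy => exact add_mem hx hy
  | smul c x _ hx => exact Submodule.smul_mem _ c hx
  | lie x y _ _ hx hy =>
    refine eigenspan_mono hB (apply_apply_mem_eigenspan_add
      (LieModule.toEnd K L L : L →ₗ[K] L →ₗ[K] L) (fun x y => ?_) hx hy)
    exact (D.apply_lie_eq_add x y).trans (add_comm _ _)

theorem exists_linearMap_apply_eq {κ K V W : Type*} [Field K] [AddCommGroup V] [Module K V]
    [AddCommGroup W] [Module K W] {v : κ → V} (hv : LinearIndependent K v) (w : κ → W) :
    ∃ g : V →ₗ[K] W, ∀ k, g (v k) = w k := by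
  obtain ⟨p, hp⟩ := (Finsupp.linearCombination K v).exists_leftInverse_of_injective
    (LinearMap.ker_eq_bot.2 hv)
  refine ⟨Finsupp.linearCombination K w ∘ₗ p, fun k => ?_⟩
  have hk : p (v k) = Finsupp.single k 1 := by
    simpa using LinearMap.congr_fun hp (Finsupp.single k 1)
  rw [LinearMap.comp_apply, hk, Finsupp.linearCombination_single, one_smul]

namespace Realization

variable {ι : Type*} [Fintype ι] {C : Matrix ι ι ℤ} {H : Type*} [AddCommGroup H] [Module ℂ H]
  (R : Realization C H)

/-- The projection of the free Lie algebra onto `g`. -/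
def proj : FreeLieAlgebra ℂ (Gen ι H) →ₗ⁅ℂ⁆ R.Alg where
  toFun z := LieSubmodule.Quotient.mk (N := R.maxIdeal)
    (LieSubmodule.Quotient.mk (N := R.relatorIdeal) z : R.Aux)
  map_add' _ _ := rfl
  map_smul' _ _ := rfl
  map_lie' := rfl

theorem proj_surjective : Function.Surjective R.proj := fun z => by
  obtain ⟨u, rfl⟩ := Quotient.mk_surjective z
  obtain ⟨w, rfl⟩ := Quotient.mk_surjective u
  exact ⟨w, rfl⟩

variable {R} in
theorem IsRelator.proj_eq_zero {z : FreeLieAlgebra ℂ (Gen ι H)} (hz : R.IsRelator z) :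
    R.proj z = 0 := by
  have h : (LieSubmodule.Quotient.mk (N := R.relatorIdeal) z : R.Aux) = 0 :=
    (LieSubmodule.Quotient.mk_eq_zero' (N := R.relatorIdeal)).2 (LieSubmodule.subset_lieSpan hz)
  exact congrArg (LieSubmodule.Quotient.mk (N := R.maxIdeal)) h

theorem cartan_lie_gen_e (t : H) (i : ι) :
    ⁅R.cartan t, R.gen (Gen.e i)⁆ = R.root i t • R.gen (Gen.e i) :=
  sub_eq_zero.1 (IsRelator.he t i).proj_eq_zero

theorem cartan_lie_gen_f (t : H) (i : ι) :
    ⁅R.cartan t, R.gen (Gen.f i)⁆ = -(R.root i t • R.gen (Gen.f i)) :=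
  eq_neg_of_add_eq_zero_left (IsRelator.hf t i).proj_eq_zero

theorem gen_e_lie_gen_f (i : ι) : ⁅R.gen (Gen.e i), R.gen (Gen.f i)⁆ = R.cartan (R.coroot i) :=
  sub_eq_zero.1 (IsRelator.ef i).proj_eq_zero

theorem gen_e_lie_gen_f_of_ne {i j : ι} (hij : i ≠ j) : ⁅R.gen (Gen.e i), R.gen (Gen.f j)⁆ = 0 :=
  (IsRelator.ef_ne i j hij).proj_eq_zero

theorem lieSpan_range_gen : LieSubalgebra.lieSpan ℂ R.Alg (Set.range R.gen) = ⊤ := by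
  let F : FreeLieAlgebra ℂ (Gen ι H) →ₗ⁅ℂ⁆ LieSubalgebra.lieSpan ℂ R.Alg (Set.range R.gen) :=
    FreeLieAlgebra.lift ℂ fun x => ⟨R.gen x, LieSubalgebra.subset_lieSpan ⟨x, rfl⟩⟩
  have hF : (LieSubalgebra.incl _).comp F = R.proj := FreeLieAlgebra.hom_ext fun x => by
    rw [LieHom.comp_apply, FreeLieAlgebra.lift_of_apply]
    rfl
  refine eq_top_iff.2 fun z _ => ?_
  obtain ⟨w, rfl⟩ := R.proj_surjective z
  rw [← hF]
  exact (F w).2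

theorem root_coroot_self (i : ι) : R.root i (R.coroot i) = 2 := by
  rw [R.root_coroot, R.gcm.diag, Int.cast_ofNat]

theorem mem_derived_of_lie {t : H} {c : ℂ} (hc : c ≠ 0) {z : R.Alg}
    (h : ⁅R.cartan t, z⁆ = c • z) : z ∈ R.derived := by
  rw [← inv_smul_smul₀ hc z, ← h]
  exact R.derived.smul_mem _ (LieSubmodule.lie_mem_lie trivial trivial)

/-- The generator `e_i`, as an element of `g'`. -/
def e (i : ι) : R.derived :=
  ⟨R.gen (Gen.e i), R.mem_derived_of_lie two_ne_zero (by
    rw [cartan_lie_gen_e, R.root_coroot_self i])⟩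

/-- The generator `f_i`, as an element of `g'`. -/
def f (i : ι) : R.derived :=
  ⟨R.gen (Gen.f i), R.mem_derived_of_lie (neg_ne_zero.2 two_ne_zero) (by
    rw [cartan_lie_gen_f, R.root_coroot_self i, neg_smul])⟩

theorem adCartan_e (t : H) (i : ι) : R.adCartan t (R.e i) = R.root i t • R.e i :=
  Subtype.ext (R.cartan_lie_gen_e t i)

theorem adCartan_f (t : H) (i : ι) : R.adCartan t (R.f i) = -R.root i t • R.f i := by
  rw [neg_smul]
  exact Subtype.ext (R.cartan_lie_gen_f t i)

/-- The coroot `α_i^∨`, as an element of `h'`. -/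
def coroot' (i : ι) : R.cartan' :=
  ⟨R.coroot i, by
    rw [cartan', Submodule.mem_comap, ← gen_e_lie_gen_f]
    exact LieSubmodule.lie_mem_lie trivial trivial⟩

theorem cartanToDerived_lie (s : R.cartan') (z : R.derived) :
    ⁅R.cartanToDerived s, z⁆ = R.adCartan s z := rfl

theorem adCartan_cartanToDerived (t : H) (s : R.cartan') :
    R.adCartan t (R.cartanToDerived s) = 0 :=
  Subtype.ext (R.cartan_lie_cartan t s)

theorem e_lie_f (i : ι) : ⁅R.e i, R.f i⁆ = R.cartanToDerived (R.coroot' i) :=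
  Subtype.ext (R.gen_e_lie_gen_f i)

theorem e_lie_f_of_ne {i j : ι} (hij : i ≠ j) : ⁅R.e i, R.f j⁆ = 0 :=
  Subtype.ext (R.gen_e_lie_gen_f_of_ne hij)

theorem lie_mem_lieSpan_e_f (x y : R.Alg) :
    ⁅x, y⁆ ∈ LieSubalgebra.lieSpan ℂ R.Alg
      (Set.range (fun i => R.gen (Gen.e i)) ∪ Set.range fun i => R.gen (Gen.f i)) := by
  refine lie_mem_lieSpan_of_commuting (T := LinearMap.range R.cartan) ?_ ?_ ?_ x y
  · rintro _ ⟨s, rfl⟩ _ ⟨t, rfl⟩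
    exact R.cartan_lie_cartan s t
  · rintro _ ⟨t, rfl⟩ _ (⟨i, rfl⟩ | ⟨i, rfl⟩)
    · rw [cartan_lie_gen_e]
      exact LieSubalgebra.smul_mem _ _ (LieSubalgebra.subset_lieSpan (Or.inl ⟨i, rfl⟩))
    · rw [cartan_lie_gen_f]
      exact neg_mem (LieSubalgebra.smul_mem _ _ (LieSubalgebra.subset_lieSpan (Or.inr ⟨i, rfl⟩)))
  · refine top_unique (R.lieSpan_range_gen.ge.trans (LieSubalgebra.lieSpan_mono ?_))
    rintro _ ⟨i | i | t, rfl⟩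
    · exact Or.inl (Or.inl ⟨i, rfl⟩)
    · exact Or.inl (Or.inr ⟨i, rfl⟩)
    · exact Or.inr ⟨t, rfl⟩

theorem lieSpan_e_f :
    LieSubalgebra.lieSpan ℂ R.derived (Set.range R.e ∪ Set.range R.f) = ⊤ := by
  have hle : R.derived.toSubmodule ≤
      ((LieSubalgebra.lieSpan ℂ R.derived (Set.range R.e ∪ Set.range R.f)).map
        R.derived.incl).toSubmodule := by
    rw [LieSubalgebra.map_lieSpan, Set.image_union, ← Set.range_comp, ← Set.range_comp]
    refine (LieSubmodule.lieIdeal_oper_eq_linear_span' ⊤ (⊤ : LieIdeal ℂ R.Alg)).trans_le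
      (Submodule.span_le.2 ?_)
    rintro _ ⟨x, -, y, -, rfl⟩
    exact R.lie_mem_lieSpan_e_f x y
  refine eq_top_iff.2 fun z _ => ?_
  obtain ⟨w, hw, hwz⟩ := hle z.2
  rwa [← Subtype.ext (a1 := w) (a2 := z) hwz]

/-- The span of the coroots in `g'`. -/
def corootSpan : Submodule ℂ R.derived :=
  Submodule.span ℂ (Set.range fun i => R.cartanToDerived (R.coroot' i))

theorem corootSpan_le_range : R.corootSpan ≤ LinearMap.range R.cartanToDerived :=
  Submodule.span_le.2 (Set.range_subset_iff.2 fun i => ⟨R.coroot' i, rfl⟩)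

theorem triangular_decomposition :
    R.corootSpan ⊔ (LieSubalgebra.lieSpan ℂ R.derived (Set.range R.e)).toSubmodule ⊔
      (LieSubalgebra.lieSpan ℂ R.derived (Set.range R.f)).toSubmodule = ⊤ := by
  refine triangular_eq_top ?_ ?_ ?_ R.lieSpan_e_f
  · rintro _ ht _ ⟨i, rfl⟩
    obtain ⟨s, rfl⟩ := R.corootSpan_le_range ht
    rw [cartanToDerived_lie, adCartan_e]
    exact LieSubalgebra.smul_mem _ _ (LieSubalgebra.subset_lieSpan ⟨i, rfl⟩)
  · rintro _ ht _ ⟨i, rfl⟩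
    obtain ⟨s, rfl⟩ := R.corootSpan_le_range ht
    rw [cartanToDerived_lie, adCartan_f]
    exact LieSubalgebra.smul_mem _ _ (LieSubalgebra.subset_lieSpan ⟨i, rfl⟩)
  · rintro _ ⟨i, rfl⟩ _ ⟨j, rfl⟩
    rcases eq_or_ne i j with rfl | hij
    · rw [e_lie_f]
      exact Submodule.subset_span ⟨i, rfl⟩
    · rw [R.e_lie_f_of_ne hij]
      exact zero_mem _

theorem exists_grading_element : ∃ t : H, ∀ i, R.root i t = 1 := by
  have := R.finiteDimensional
  obtain ⟨g, hg⟩ := exists_linearMap_apply_eq R.linearIndependent_root fun _ => (1 : ℂ)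
  exact ⟨(Module.evalEquiv ℂ H).symm g, fun i => by
    rw [Module.apply_evalEquiv_symm_apply, hg]⟩

section Grading

variable {R} {t : H} (ht : ∀ i, R.root i t = 1)
include ht

theorem lieSpan_e_le_eigenspan :
    (LieSubalgebra.lieSpan ℂ R.derived (Set.range R.e)).toSubmodule ≤
      eigenspan (R.adCartan t : R.derived →ₗ[ℂ] R.derived) (Set.Ioi 0) := by
  refine lieSpan_le_eigenspan _
    (Set.add_subset_iff.2 fun _ ha _ hb => Set.mem_Ioi.2 (add_pos ha hb)) ?_
  rintro _ ⟨i, rfl⟩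
  exact mem_eigenspan (Set.mem_Ioi.2 one_pos) ((R.adCartan_e t i).trans (by rw [ht]))

theorem lieSpan_f_le_eigenspan :
    (LieSubalgebra.lieSpan ℂ R.derived (Set.range R.f)).toSubmodule ≤
      eigenspan (R.adCartan t : R.derived →ₗ[ℂ] R.derived) (Set.Iio 0) := by
  refine lieSpan_le_eigenspan _
    (Set.add_subset_iff.2 fun _ ha _ hb => Set.mem_Iio.2 (add_neg ha hb)) ?_
  rintro _ ⟨i, rfl⟩
  exact mem_eigenspan (Set.mem_Iio.2 (neg_lt_zero.2 one_pos))
    ((R.adCartan_f t i).trans (by rw [ht]))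

end Grading

theorem cartanToDerived_mem_corootSpan (s : R.cartan') : R.cartanToDerived s ∈ R.corootSpan := by
  obtain ⟨t, ht⟩ := R.exists_grading_element
  set D : Module.End ℂ R.derived := (R.adCartan t : R.derived →ₗ[ℂ] R.derived)
  have hs : R.cartanToDerived s ∈ (⊤ : Submodule ℂ R.derived) := trivial
  rw [← R.triangular_decomposition, sup_assoc] at hs
  obtain ⟨c, hc, z, hz, hcz⟩ := Submodule.mem_sup.1 hs
  have hne : z ∈ eigenspan D {0}ᶜ := by
    refine (sup_le ?_ ?_ : _ ≤ eigenspan D {0}ᶜ) hz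
    · exact (lieSpan_e_le_eigenspan ht).trans (eigenspan_mono fun _ h => h.ne')
    · exact (lieSpan_f_le_eigenspan ht).trans (eigenspan_mono fun _ h => h.ne)
  have hzero : z ∈ eigenspan D {0} := by
    obtain ⟨s', rfl⟩ := R.corootSpan_le_range hc
    rw [mem_eigenspan_singleton, zero_smul, ← sub_eq_of_eq_add' hcz.symm, ← map_sub]
    exact R.adCartan_cartanToDerived t (s - s')
  have hz0 : z = 0 :=
    Submodule.disjoint_def.1 (disjoint_eigenspan disjoint_compl_right) z hzero hne
  rw [← hcz, hz0, add_zero]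
  exact hc

theorem e_mem_nPos (i : ι) : (R.e i : R.Alg) ∈ R.nPos := by
  classical
  rcases eq_or_ne (R.e i : R.Alg) 0 with h | h
  · rw [h]
    exact zero_mem _
  have hmem : (R.e i : R.Alg) ∈ R.rootSpace (R.root i) := fun t => R.cartan_lie_gen_e t i
  refine Submodule.mem_iSup_of_mem _ (Submodule.mem_iSup_of_mem
    ⟨R.linearIndependent_root.ne_zero i, Submodule.ne_bot_iff _ |>.2 ⟨_, hmem, h⟩,
      Pi.single i 1, ?_⟩ hmem)
  simp [Pi.single_apply]

theorem f_mem_rootSpace (i : ι) : (R.f i : R.Alg) ∈ R.rootSpace (-R.root i) := fun t => by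
  rw [LinearMap.neg_apply, neg_smul]
  exact R.cartan_lie_gen_f t i

theorem isRealRoot_neg_root (i : ι) : R.IsRealRoot (-R.root i) :=
  ⟨_, Subgroup.subset_closure ⟨i, rfl⟩, i,
    (Module.reflection_apply_self (R.eval_coroot_root i)).symm⟩

end Realization

theorem eq_zero_of_commute_lie_of_pow_apply_eq_zero {K V : Type*} [Field K] [CharZero K]
    [AddCommGroup V] [Module K V] {E F : Module.End K V} (hEF : Commute ⁅E, F⁆ F) {v : V}
    (hv : v ≠ 0) (he : E v = 0) {c : K} (hc : ⁅E, F⁆ v = c • v) {k : ℕ} (hk : (F ^ k) v = 0) :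
    c = 0 := by
  have hlie (n : ℕ) : ⁅E, F⁆ ((F ^ n) v) = c • (F ^ n) v := by
    rw [← Module.End.mul_apply, (hEF.pow_right n).eq, Module.End.mul_apply, hc, map_smul]
  have hE (n : ℕ) : E ((F ^ (n + 1)) v) = ((n + 1 : ℕ) * c) • (F ^ n) v := by
    have hstep (w : V) : E (F w) = ⁅E, F⁆ w + F (E w) := by simp [Ring.lie_def]
    induction n with
    | zero => rw [zero_add, pow_one, hstep, he, hc]; simp
    | succ n ih =>
      rw [pow_succ', Module.End.mul_apply, hstep, ih, hlie, map_smul, ← Module.End.mul_apply,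
        ← pow_succ', ← add_smul]
      push_cast
      ring_nf
  by_contra hc0
  suffices hne : ∀ n, (F ^ n) v ≠ 0 from hne k hk
  intro n
  induction n with
  | zero => exact hv
  | succ n ih =>
    intro h
    have hn := hE n
    rw [h, map_zero, eq_comm] at hn
    exact smul_ne_zero (mul_ne_zero (Nat.cast_ne_zero.2 n.succ_ne_zero) hc0) ih hn

section VanishingIdeal

variable {K A M N : Type*} [CommRing K] [CommRing A] [Algebra K A] [AddCommGroup M] [Module K M]
  [AddCommGroup N] [Module K N] {φ : A ⊗[K] M →ₗ[K] N}

/-- The largest ideal `J` of `A` such that `φ` vanishes on the image of `J ⊗ M`. -/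
def vanishingIdeal (φ : A ⊗[K] M →ₗ[K] N) : Ideal A where
  carrier := {a | ∀ (b : A) (m : M), φ ((b * a) ⊗ₜ m) = 0}
  add_mem' ha ha' b m := by
    rw [mul_add, TensorProduct.add_tmul, map_add, ha, ha', add_zero]
  zero_mem' b m := by rw [mul_zero, TensorProduct.zero_tmul, map_zero]
  smul_mem' _ _ ha b m := by rw [smul_eq_mul, ← mul_assoc, ha]

theorem apply_tmul_eq_zero {a : A} (ha : a ∈ vanishingIdeal φ) (m : M) : φ (a ⊗ₜ m) = 0 := by
  simpa only [one_mul] using ha 1 m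

theorem le_vanishingIdeal {I : Ideal A} (h : ∀ a ∈ I, ∀ m : M, φ (a ⊗ₜ m) = 0) :
    I ≤ vanishingIdeal φ :=
  fun _ ha b => h _ (I.mul_mem_left b ha)

end VanishingIdeal

namespace Realization

variable {ι : Type*} [Fintype ι] {C : Matrix ι ι ℤ} {H : Type*} [AddCommGroup H] [Module ℂ H]
  (R : Realization C H) (S : Submodule ℂ H) {A : Type*} [CommRing A] [Algebra ℂ A]
  {V : Type*} [AddCommGroup V] [Module ℂ V] [LieRingModule (R.Current S A) V]
  [LieModule ℂ (R.Current S A) V]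

section Action

variable (V) in
/-- The action of `x ⊗ a` on a `g_A`-module, for `x ∈ g'`. -/
def currentAct : A →ₗ[ℂ] R.derived →ₗ[ℂ] Module.End ℂ V :=
  TensorProduct.curry
    ((LieModule.toEnd ℂ (R.Current S A) V : R.Current S A →ₗ[ℂ] Module.End ℂ V) ∘ₗ
      (LieAlgebra.SemiDirectSum.inl (R.complAct S A) : A ⊗[ℂ] R.derived →ₗ[ℂ] R.Current S A))

variable (A V) in
/-- The action of `s ⊗ 1 + t` on a `g_A`-module, for `s ∈ h'` and `t ∈ h''`. -/
def cartanAct (s : R.cartan') (t : S) : Module.End ℂ V :=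
  LieModule.toEnd ℂ (R.Current S A) V (Current.mk R S (1 ⊗ₜ[ℂ] R.cartanToDerived s) t)

theorem lie_currentAct (a b : A) (x y : R.derived) :
    ⁅R.currentAct S V a x, R.currentAct S V b y⁆ = R.currentAct S V (a * b) ⁅x, y⁆ := by
  have h : ⁅(Current.mk R S (a ⊗ₜ[ℂ] x) 0 : R.Current S A), Current.mk R S (b ⊗ₜ[ℂ] y) 0⁆ =
      Current.mk R S ((a * b) ⊗ₜ[ℂ] ⁅x, y⁆) 0 := by
    simp [LieAlgebra.SemiDirectSum.lie_eq_mk, Current.mk]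
  exact LinearMap.ext fun w => (lie_lie _ _ w).symm.trans (congrArg (⁅·, w⁆) h)

theorem lie_cartanAct_currentAct (s : R.cartan') (t : S) (a : A) (x : R.derived) :
    ⁅R.cartanAct S A V s t, R.currentAct S V a x⁆ =
      R.currentAct S V a (R.adCartan (s + t) x) := by
  have ht : R.complAct S A (AbelianLie.of S t) (a ⊗ₜ[ℂ] x) = a ⊗ₜ[ℂ] R.adCartan t x := rfl
  have h : ⁅(Current.mk R S (1 ⊗ₜ[ℂ] R.cartanToDerived s) t : R.Current S A),
      Current.mk R S (a ⊗ₜ[ℂ] x) 0⁆ = Current.mk R S (a ⊗ₜ[ℂ] R.adCartan (s + t) x) 0 := by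
    rw [adCartan_add, TensorProduct.tmul_add, ← cartanToDerived_lie, ← ht]
    simp [LieAlgebra.SemiDirectSum.lie_eq_mk, Current.mk]
  exact LinearMap.ext fun w => (lie_lie _ _ w).symm.trans (congrArg (⁅·, w⁆) h)

theorem commute_cartanAct_currentAct (s s' : R.cartan') (t : S) (a : A) :
    Commute (R.cartanAct S A V s t) (R.currentAct S V a (R.cartanToDerived s')) := by
  rw [commute_iff_lie_eq, lie_cartanAct_currentAct, adCartan_cartanToDerived, map_zero]

theorem commute_cartanAct (s s' : R.cartan') (t t' : S) :
    Commute (R.cartanAct S A V s t) (R.cartanAct S A V s' t') := by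
  have hact (t : S) (s : R.cartan') :
      R.complAct S A (AbelianLie.of S t) ((1 : A) ⊗ₜ[ℂ] R.cartanToDerived s) = 0 :=
    (congrArg _ (R.adCartan_cartanToDerived t s)).trans (TensorProduct.tmul_zero _ _)
  have h : ⁅(Current.mk R S (1 ⊗ₜ[ℂ] R.cartanToDerived s) t : R.Current S A),
      Current.mk R S ((1 : A) ⊗ₜ[ℂ] R.cartanToDerived s') t'⁆ = 0 := by
    rw [LieAlgebra.SemiDirectSum.lie_eq_mk, hact, hact, LieAlgebra.ExtendScalars.bracket_tmul,
      cartanToDerived_lie, adCartan_cartanToDerived, TensorProduct.tmul_zero, add_zero, sub_zero]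
    rfl
  rw [commute_iff_lie_eq]
  exact LinearMap.ext fun w => (lie_lie _ _ w).symm.trans ((congrArg (⁅·, w⁆) h).trans (zero_lie w))

theorem currentAct_apply_currentAct (a b : A) (x y : R.derived) (w : V) :
    R.currentAct S V a x (R.currentAct S V b y w) =
      R.currentAct S V (a * b) ⁅x, y⁆ w + R.currentAct S V b y (R.currentAct S V a x w) := by
  rw [← lie_currentAct, Ring.lie_def, LinearMap.sub_apply, Module.End.mul_apply,
    Module.End.mul_apply, sub_add_cancel]

theorem cartanAct_apply_currentAct (s : R.cartan') (t : S) (a : A) (x : R.derived) (w : V) :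
    R.cartanAct S A V s t (R.currentAct S V a x w) =
      R.currentAct S V a (R.adCartan (s + t) x) w +
        R.currentAct S V a x (R.cartanAct S A V s t w) := by
  rw [← lie_cartanAct_currentAct, Ring.lie_def, LinearMap.sub_apply, Module.End.mul_apply,
    Module.End.mul_apply, sub_add_cancel]

variable {R S}

theorem currentAct_mem_eigenspan_add {s : R.cartan'} {t : S} {B B' : Set ℂ} (a : A) {x : R.derived}
    (hx : x ∈ eigenspan (R.adCartan (s + t) : R.derived →ₗ[ℂ] R.derived) B) {w : V}
    (hw : w ∈ eigenspan (R.cartanAct S A V s t) B') :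
    R.currentAct S V a x w ∈ eigenspan (R.cartanAct S A V s t) (B + B') :=
  apply_apply_mem_eigenspan_add (R.currentAct S V a) (R.cartanAct_apply_currentAct S s t a) hx hw

theorem currentAct_mem_of_mem_lieSpan {P Q : Submodule ℂ V} (hQP : Q ≤ P) {Y : Set R.derived}
    (hY : ∀ x ∈ Y, ∀ a : A, ∀ w ∈ P, R.currentAct S V a x w ∈ Q) {x : R.derived}
    (hx : x ∈ LieSubalgebra.lieSpan ℂ R.derived Y) (a : A) {w : V} (hw : w ∈ P) :
    R.currentAct S V a x w ∈ Q :=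
  tmul_mem_of_mem_lieSpan
    (N := (transporter hQP).comap (LieAlgebra.SemiDirectSum.inl (R.complAct S A))) hY hx a w hw

end Action

section Irreducible

variable [LieModule.IsIrreducible ℂ (R.Current S A) V]

variable {R S}

theorem eq_bot_or_eq_top_of_stable {M : Submodule ℂ V}
    (hM : ∀ (a : A) (x : R.derived), ∀ w ∈ M, R.currentAct S V a x w ∈ M)
    (ht : ∀ t : S, ∀ w ∈ M, R.cartanAct S A V 0 t w ∈ M) : M = ⊥ ∨ M = ⊤ := by
  have hlie : ∀ (z : R.Current S A), ∀ w ∈ M, ⁅z, w⁆ ∈ M := by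
    rintro ⟨y, t⟩ w hw
    have hyt : (⟨y, t⟩ : R.Current S A) =
        Current.mk R S y 0 + Current.mk R S ((1 : A) ⊗ₜ[ℂ] R.cartanToDerived 0) t :=
      LieAlgebra.SemiDirectSum.ext (by simp [Current.mk]) (zero_add t).symm
    rw [hyt, add_lie]
    refine add_mem ?_ (ht t w hw)
    have hy : (⊤ : Submodule ℂ (A ⊗[ℂ] R.derived)) ≤ ((transporter (le_refl M)).comap
        (LieAlgebra.SemiDirectSum.inl (R.complAct S A))).toSubmodule := by
      rw [← TensorProduct.span_tmul_eq_top, Submodule.span_le]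
      rintro _ ⟨a, x, rfl⟩
      exact hM a x
    exact hy (Submodule.mem_top : y ∈ ⊤) w hw
  let N : LieSubmodule ℂ (R.Current S A) V := { M with lie_mem := hlie _ _ }
  exact (eq_bot_or_eq_top N).imp (congrArg LieSubmodule.toSubmodule)
    (congrArg LieSubmodule.toSubmodule)

end Irreducible

section LowerCore

variable (A V)

/-- The largest subspace of `V` stable under all `e_i ⊗ a` on which `s + t` has only eigenvalues
less than `c`. -/
def lowerCore (s : R.cartan') (t : S) (c : ℂ) : Submodule ℂ V :=
  stableCore (fun k : A × ι => R.currentAct S V k.1 (R.e k.2))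
    (eigenspan (R.cartanAct S A V s t) (Set.Iio c))

variable {R S A V} {s : R.cartan'} {t : S} {c : ℂ} {w : V}

theorem e_apply_mem_lowerCore (a : A) (i : ι) (hw : w ∈ R.lowerCore S A V s t c) :
    R.currentAct S V a (R.e i) w ∈ R.lowerCore S A V s t c :=
  apply_mem_stableCore (a, i) hw

theorem cartan'_apply_mem_lowerCore (a : A) (s' : R.cartan') (hw : w ∈ R.lowerCore S A V s t c) :
    R.currentAct S V a (R.cartanToDerived s') w ∈ R.lowerCore S A V s t c := by
  refine apply_mem_stableCore_of_commutator
    (fun u hu => apply_mem_eigenspan_of_commute (R.commute_cartanAct_currentAct S s s' t a) hu)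
    (fun ⟨b, i⟩ u hu => ?_) hw
  rw [currentAct_apply_currentAct, add_sub_cancel_right, ← lie_skew, cartanToDerived_lie,
    adCartan_e, map_neg, map_smul]
  exact neg_mem (Submodule.smul_mem _ _ (e_apply_mem_lowerCore (b * a) i hu))

theorem cartanAct_apply_mem_lowerCore (t' : S) (hw : w ∈ R.lowerCore S A V s t c) :
    R.cartanAct S A V 0 t' w ∈ R.lowerCore S A V s t c := by
  refine apply_mem_stableCore_of_commutator
    (fun u hu => apply_mem_eigenspan_of_commute (R.commute_cartanAct S s 0 t t') hu)
    (fun ⟨b, i⟩ u hu => ?_) hw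
  rw [cartanAct_apply_currentAct, sub_add_cancel_right, adCartan_e, map_smul]
  exact neg_mem (Submodule.smul_mem _ _ (e_apply_mem_lowerCore b i hu))

variable (hst : ∀ i, R.root i (s + t) = 1)
include hst

theorem f_apply_mem_lowerCore (a : A) (j : ι) (hw : w ∈ R.lowerCore S A V s t c) :
    R.currentAct S V a (R.f j) w ∈ R.lowerCore S A V s t c := by
  refine apply_mem_stableCore_of_commutator (fun u hu => ?_) (fun ⟨b, i⟩ u hu => ?_) hw
  · have hf : R.f j ∈ (LieSubalgebra.lieSpan ℂ R.derived (Set.range R.f)).toSubmodule :=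
      LieSubalgebra.subset_lieSpan ⟨j, rfl⟩
    have hc : Set.Iio 0 + Set.Iio c ⊆ Set.Iio c :=
      Set.add_subset_iff.2 fun _ ha _ hb => Set.mem_Iio.2 (add_lt_of_neg_of_lt ha hb)
    exact eigenspan_mono hc (currentAct_mem_eigenspan_add a (lieSpan_f_le_eigenspan hst hf) hu)
  · rw [currentAct_apply_currentAct, add_sub_cancel_right]
    rcases eq_or_ne i j with rfl | hij
    · rw [e_lie_f]
      exact cartan'_apply_mem_lowerCore (b * a) (R.coroot' i) hu
    · rw [e_lie_f_of_ne R hij, map_zero]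
      exact zero_mem _

theorem currentAct_apply_mem_lowerCore (a : A) (x : R.derived)
    (hw : w ∈ R.lowerCore S A V s t c) :
    R.currentAct S V a x w ∈ R.lowerCore S A V s t c := by
  refine currentAct_mem_of_mem_lieSpan le_rfl (fun x hx a w hw => ?_)
    (R.lieSpan_e_f ▸ LieSubalgebra.mem_top x) a hw
  obtain ⟨i, rfl⟩ | ⟨i, rfl⟩ := hx
  · exact e_apply_mem_lowerCore a i hw
  · exact f_apply_mem_lowerCore hst a i hw

theorem eq_bot_of_le_eigenspan_Iio [LieModule.IsIrreducible ℂ (R.Current S A) V] {v : V}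
    (hv : v ≠ 0) (hvc : R.cartanAct S A V s t v = c • v) {X : Submodule ℂ V}
    (hX : X ≤ eigenspan (R.cartanAct S A V s t) (Set.Iio c))
    (hE : ∀ (a : A) i, ∀ w ∈ X, R.currentAct S V a (R.e i) w ∈ X) : X = ⊥ := by
  have hXM : X ≤ R.lowerCore S A V s t c := le_stableCore hX fun k => hE k.1 k.2
  obtain hM | hM := eq_bot_or_eq_top_of_stable (M := R.lowerCore S A V s t c)
    (fun a x _ => currentAct_apply_mem_lowerCore hst a x)
    fun t' _ => cartanAct_apply_mem_lowerCore t'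
  · exact le_bot_iff.1 (hM ▸ hXM)
  · have hvM : v ∈ R.lowerCore S A V s t c := hM ▸ Submodule.mem_top
    have hdisj : Disjoint ({c} : Set ℂ) (Set.Iio c) := by simp
    exact absurd (Submodule.disjoint_def.1 (disjoint_eigenspan hdisj) v
      (mem_eigenspan_singleton.2 hvc) (stableCore_le hvM)) hv

end LowerCore

theorem exists_grading_pair {S : Submodule ℂ H} (hS : Codisjoint R.cartan' S) :
    ∃ (s : R.cartan') (t : S), ∀ i, R.root i (s + t) = 1 := by
  obtain ⟨h, hh⟩ := R.exists_grading_element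
  obtain ⟨s, hs, t, ht, rfl⟩ := Submodule.mem_sup.1 (hS.eq_top ▸ Submodule.mem_top : h ∈ _)
  exact ⟨⟨s, hs⟩, ⟨t, ht⟩, hh⟩

variable (V) in
/-- `v` is a nonzero vector of highest weight `ψ`, in terms of the generators `e_i` of `n₊`. -/
structure IsHighestWeightVector (ψ : (A ⊗[ℂ] R.cartan') × S →ₗ[ℂ] ℂ) (v : V) : Prop where
  ne_zero : v ≠ 0
  e_apply : ∀ (a : A) (i : ι), R.currentAct S V a (R.e i) v = 0
  cartan'_apply : ∀ (a : A) (s : R.cartan'),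
    R.currentAct S V a (R.cartanToDerived s) v = ψ (a ⊗ₜ s, 0) • v
  cartanAct_apply : ∀ (s : R.cartan') (t : S), R.cartanAct S A V s t v = ψ (1 ⊗ₜ s, t) • v

variable {R S} {ψ : (A ⊗[ℂ] R.cartan') × S →ₗ[ℂ] ℂ}

theorem IsHighestWeight.exists_isHighestWeightVector (h : R.IsHighestWeight S A V ψ) :
    ∃ v : V, R.IsHighestWeightVector S V ψ v := by
  obtain ⟨v, hv, -, he, hψ⟩ := h
  exact ⟨v, hv, fun a i => he a _ (R.e_mem_nPos i), fun a s => hψ (a ⊗ₜ s) 0,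
    fun s t => hψ (1 ⊗ₜ s) t⟩

/-- The restriction of `ψ` to `h = (h' ⊗ 1) ⊕ h''`. -/
def cartanWeight (hS : IsCompl R.cartan' S) (ψ : (A ⊗[ℂ] R.cartan') × S →ₗ[ℂ] ℂ) :
    Module.Dual ℂ H :=
  ψ ∘ₗ LinearMap.prodMap (TensorProduct.mk ℂ A R.cartan' 1) LinearMap.id ∘ₗ
    (Submodule.prodEquivOfIsCompl _ _ hS).symm

theorem cartanWeight_add (hS : IsCompl R.cartan' S) (s : R.cartan') (t : S) :
    cartanWeight hS ψ (s + t) = ψ (1 ⊗ₜ s, t) := by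
  simp [cartanWeight]

variable (ψ) in
/-- The largest ideal `J` of `A` such that `ψ` vanishes on `h' ⊗ J`. -/
abbrev weightIdeal : Ideal A := vanishingIdeal (ψ ∘ₗ LinearMap.inl ℂ (A ⊗[ℂ] R.cartan') S)

namespace IsHighestWeightVector

variable {v : V} (hv : R.IsHighestWeightVector S V ψ v)
include hv

theorem lieSpan_e_apply (a : A) {x : R.derived}
    (hx : x ∈ LieSubalgebra.lieSpan ℂ R.derived (Set.range R.e)) : R.currentAct S V a x v = 0 := by
  refine (Submodule.mem_bot ℂ).1 (currentAct_mem_of_mem_lieSpan (bot_le : ⊥ ≤ ℂ ∙ v) ?_ hx a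
    (Submodule.mem_span_singleton_self v))
  rintro _ ⟨i, rfl⟩ a w hw
  obtain ⟨c, rfl⟩ := Submodule.mem_span_singleton.1 hw
  rw [map_smul, hv.e_apply, smul_zero]
  exact zero_mem _

theorem cartan'_apply_eq_zero {a : A} (ha : a ∈ weightIdeal ψ) (s : R.cartan') :
    R.currentAct S V a (R.cartanToDerived s) v = 0 := by
  have h : ψ (a ⊗ₜ s, 0) = 0 := apply_tmul_eq_zero ha s
  rw [hv.cartan'_apply, h, zero_smul]

theorem mem_weightIdeal_of_coroot {a : A} (ha : ∀ (b : A) i, ψ ((b * a) ⊗ₜ R.coroot' i, 0) = 0) :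
    a ∈ weightIdeal ψ := by
  intro b s
  have hle : R.corootSpan ≤ LinearMap.ker ((R.currentAct S V (b * a)).flip v) := by
    refine Submodule.span_le.2 ?_
    rintro _ ⟨i, rfl⟩
    exact (hv.cartan'_apply _ _).trans (by rw [ha, zero_smul])
  have h : R.currentAct S V (b * a) _ v = 0 := hle (R.cartanToDerived_mem_corootSpan s)
  rw [hv.cartan'_apply] at h
  exact (smul_eq_zero.1 h).resolve_right hv.ne_zero

theorem e_apply_f_apply (a b : A) (i : ι) :
    R.currentAct S V a (R.e i) (R.currentAct S V b (R.f i) v) =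
      ψ ((a * b) ⊗ₜ R.coroot' i, 0) • v := by
  rw [currentAct_apply_currentAct, e_lie_f, hv.cartan'_apply, hv.e_apply, map_zero, add_zero]

theorem f_apply_mem_weightSpace (hS : IsCompl R.cartan' S) (a : A) (i : ι) :
    R.currentAct S V a (R.f i) v ∈ R.weightSpace S A V (cartanWeight hS ψ - R.root i) := by
  intro s t
  refine (R.cartanAct_apply_currentAct S s t a (R.f i) v).trans ?_
  rw [hv.cartanAct_apply, adCartan_f, LinearMap.sub_apply, cartanWeight_add, map_smul, map_smul,
    LinearMap.smul_apply, ← add_smul, neg_add_eq_sub]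

theorem isCofinite_weightIdeal (hS : IsCompl R.cartan' S) (hfin : R.HasFiniteWeightSpaces S A V) :
    IsCofinite (weightIdeal ψ) := by
  have (i : ι) := hfin (cartanWeight hS ψ - R.root i)
  let g := LinearMap.pi fun i => LinearMap.codRestrict _
    (((R.currentAct S V).flip (R.f i)).flip v) fun a => hv.f_apply_mem_weightSpace hS a i
  refine finite_of_ker_le_ker (g := g) (p := (Ideal.Quotient.mkₐ ℂ (weightIdeal ψ)).toLinearMap)
    (Ideal.Quotient.mkₐ_surjective ℂ _) fun a ha => ?_
  have hfa (i : ι) : R.currentAct S V a (R.f i) v = 0 :=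
    congrArg Subtype.val (congrFun (LinearMap.mem_ker.1 ha) i)
  refine Ideal.Quotient.eq_zero_iff_mem.2 (hv.mem_weightIdeal_of_coroot fun b i => ?_)
  have h := hv.e_apply_f_apply b a i
  rw [hfa, map_zero, eq_comm] at h
  exact (smul_eq_zero.1 h).resolve_right hv.ne_zero

variable [LieModule.IsIrreducible ℂ (R.Current S A) V]

theorem currentAct_vector_eq_zero (hS : Codisjoint R.cartan' S) {a : A} (ha : a ∈ weightIdeal ψ)
    (x : R.derived) : R.currentAct S V a x v = 0 := by
  obtain ⟨s, t, hst⟩ := R.exists_grading_pair hS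
  let X : Submodule ℂ V :=
    Submodule.span ℂ {w | ∃ a ∈ weightIdeal ψ, ∃ x, R.currentAct S V a x v = w}
  suffices hX : X = ⊥ from
    (Submodule.mem_bot ℂ).1 (hX ▸ Submodule.subset_span ⟨a, ha, x, rfl⟩)
  have hvc := hv.cartanAct_apply s t
  refine eq_bot_of_le_eigenspan_Iio hst hv.ne_zero hvc (Submodule.span_le.2 ?_) fun b i => ?_
  · rintro _ ⟨a, ha, x, rfl⟩
    have hx : x ∈ (⊤ : Submodule ℂ R.derived) := trivial
    rw [← R.triangular_decomposition] at hx
    obtain ⟨y, hy, z, hz, rfl⟩ := Submodule.mem_sup.1 hx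
    obtain ⟨r, hr, n, hn, rfl⟩ := Submodule.mem_sup.1 hy
    obtain ⟨s', rfl⟩ := R.corootSpan_le_range hr
    rw [map_add, map_add, LinearMap.add_apply, LinearMap.add_apply, hv.cartan'_apply_eq_zero ha,
      hv.lieSpan_e_apply a hn, zero_add, zero_add]
    have hlt := currentAct_mem_eigenspan_add a (lieSpan_f_le_eigenspan hst hz)
      (mem_eigenspan_singleton.2 hvc)
    rwa [Set.add_singleton, Set.image_add_const_Iio, zero_add] at hlt
  · suffices h : X ≤ X.comap (R.currentAct S V b (R.e i)) from fun w hw => h hw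
    refine Submodule.span_le.2 ?_
    rintro _ ⟨a, ha, x, rfl⟩
    rw [SetLike.mem_coe, Submodule.mem_comap, currentAct_apply_currentAct, hv.e_apply, map_zero,
      add_zero]
    exact Submodule.subset_span ⟨b * a, Ideal.mul_mem_left _ b ha, _, rfl⟩

theorem currentAct_eq_zero (hS : Codisjoint R.cartan' S) {a : A} (ha : a ∈ weightIdeal ψ)
    (x : R.derived) : R.currentAct S V a x = 0 := by
  let M : Submodule ℂ V :=
    ⨅ (a : weightIdeal ψ) (x : R.derived), LinearMap.ker (R.currentAct S V a.1 x)
  have hmem {w : V} : w ∈ M ↔ ∀ a ∈ weightIdeal ψ, ∀ x, R.currentAct S V a x w = 0 := by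
    simp [M, Submodule.mem_iInf]
  have hvM : v ∈ M := hmem.2 fun a ha x => hv.currentAct_vector_eq_zero hS ha x
  have hcurrent (b : A) (y : R.derived) (w : V) (hw : w ∈ M) : R.currentAct S V b y w ∈ M := by
    refine hmem.2 fun a ha x => ?_
    rw [currentAct_apply_currentAct, hmem.1 hw _ (Ideal.mul_mem_right b _ ha), hmem.1 hw a ha,
      map_zero, add_zero]
  have hcartan (t : S) (w : V) (hw : w ∈ M) : R.cartanAct S A V 0 t w ∈ M := by
    refine hmem.2 fun a ha x => ?_
    have h := R.cartanAct_apply_currentAct S 0 t a x w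
    rw [hmem.1 hw a ha, hmem.1 hw a ha, map_zero, zero_add] at h
    exact h.symm
  obtain hM | hM := eq_bot_or_eq_top_of_stable hcurrent hcartan
  · exact absurd ((Submodule.mem_bot ℂ).1 (hM ▸ hvM)) hv.ne_zero
  · exact LinearMap.ext fun w => hmem.1 (hM ▸ Submodule.mem_top) a ha x

theorem coroot_eq_zero_of_sq_mem (hS : Codisjoint R.cartan' S) {a : A}
    (ha : a ^ 2 ∈ weightIdeal ψ) {i : ι} {k : ℕ} (hk : ((R.currentAct S V a (R.f i)) ^ k) v = 0) :
    ψ (a ⊗ₜ R.coroot' i, 0) = 0 := by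
  have hEF : ⁅R.currentAct S V (1 : A) (R.e i), R.currentAct S V a (R.f i)⁆ =
      R.currentAct S V a (R.cartanToDerived (R.coroot' i)) := by
    rw [lie_currentAct, one_mul, e_lie_f]
  refine eq_zero_of_commute_lie_of_pow_apply_eq_zero (E := R.currentAct S V 1 (R.e i)) ?_
    hv.ne_zero (hv.e_apply 1 i) (hEF ▸ hv.cartan'_apply a (R.coroot' i)) hk
  rw [commute_iff_lie_eq, hEF, lie_currentAct, ← sq, hv.currentAct_eq_zero hS ha]

theorem isRadical_weightIdeal (hS : Codisjoint R.cartan' S)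
    (hnil : ∀ i (a : A), ∃ k : ℕ, ((R.currentAct S V a (R.f i)) ^ k) v = 0) :
    (weightIdeal ψ).IsRadical := by
  rw [Ideal.isRadical_iff_quotient_reduced, isReduced_iff_pow_one_lt 2 one_lt_two]
  intro z hz
  obtain ⟨a, rfl⟩ := Ideal.Quotient.mk_surjective z
  rw [← map_pow, Ideal.Quotient.eq_zero_iff_mem] at hz
  refine Ideal.Quotient.eq_zero_iff_mem.2 (hv.mem_weightIdeal_of_coroot fun b i => ?_)
  obtain ⟨k, hk⟩ := hnil i (b * a)
  exact hv.coroot_eq_zero_of_sq_mem hS (mul_pow b a 2 ▸ Ideal.mul_mem_left _ _ hz) hk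

end IsHighestWeightVector

end Realization

theorem exists_algEquiv_pi (K B : Type*) [Field K] [IsAlgClosed K] [CommRing B] [Algebra K B]
    [Module.Finite K B] [IsReduced B] : ∃ k : ℕ, Nonempty (B ≃ₐ[K] (Fin k → K)) := by
  have : IsArtinianRing B := IsArtinianRing.of_finite K B
  let E₁ : B ≃ₐ[K] ∀ m : MaximalSpectrum B, B ⧸ m.asIdeal :=
    (IsArtinianRing.equivPi B).restrictScalars K
  have hbij (m : MaximalSpectrum B) : Function.Bijective (algebraMap K (B ⧸ m.asIdeal)) :=
    have := m.isMaximal.isPrime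
    IsAlgClosed.algebraMap_bijective_of_isIntegral
  let E₂ : (∀ m : MaximalSpectrum B, B ⧸ m.asIdeal) ≃ₐ[K] (MaximalSpectrum B → K) :=
    AlgEquiv.piCongrRight fun m =>
      (AlgEquiv.ofBijective (Algebra.ofId K (B ⧸ m.asIdeal)) (hbij m)).symm
  exact ⟨_, ⟨(E₁.trans E₂).trans
    (AlgEquiv.piCongrLeft K (fun _ => K) (Finite.equivFin (MaximalSpectrum B)))⟩⟩

section Cofinite

variable {A : Type*} [CommRing A] [Algebra ℂ A] {I J : Ideal A}

theorem IsCofinite.mono (hI : IsCofinite I) (h : I ≤ J) : IsCofinite J :=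
  have : Module.Finite ℂ (A ⧸ I) := hI
  Module.Finite.of_surjective (Ideal.Quotient.factorₐ ℂ h).toLinearMap
    (Ideal.Quotient.factor_surjective h)

theorem IsCofinite.exists_characters (hJ : IsCofinite J) (hrad : J.IsRadical) :
    ∃ (k : ℕ) (χ : Fin k → A →ₐ[ℂ] ℂ) (E : (A ⧸ J) ≃ₐ[ℂ] (Fin k → ℂ)),
      Function.Injective χ ∧ J = ⨅ i, RingHom.ker (χ i) ∧
        ∀ a, E (Ideal.Quotient.mk J a) = fun i => χ i a := by
  have : Module.Finite ℂ (A ⧸ J) := hJ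
  have : IsReduced (A ⧸ J) := (Ideal.isRadical_iff_quotient_reduced J).1 hrad
  obtain ⟨k, ⟨E⟩⟩ := exists_algEquiv_pi ℂ (A ⧸ J)
  refine ⟨k, fun i => (Pi.evalAlgHom ℂ (fun _ => ℂ) i).comp
    ((E : (A ⧸ J) →ₐ[ℂ] (Fin k → ℂ)).comp (Ideal.Quotient.mkₐ ℂ J)), E, ?_, ?_, fun a => rfl⟩
  · intro i j hij
    obtain ⟨a, ha⟩ := (E.surjective.comp Ideal.Quotient.mk_surjective) (Pi.single i 1)
    have h : E (Ideal.Quotient.mk J a) i = E (Ideal.Quotient.mk J a) j := DFunLike.congr_fun hij a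
    by_contra hne
    rw [show E (Ideal.Quotient.mk J a) = _ from ha, Pi.single_eq_same,
      Pi.single_eq_of_ne (Ne.symm hne)] at h
    exact one_ne_zero h
  · ext a
    rw [← Ideal.Quotient.eq_zero_iff_mem, ← map_eq_zero_iff E E.injective, funext_iff,
      Ideal.mem_iInf]
    rfl

end Cofinite

theorem apply_eq_zero_of_rTensor_eq_zero {K A B M N : Type*} [CommRing K] [AddCommGroup A]
    [Module K A] [AddCommGroup B] [Module K B] [AddCommGroup M] [Module K M] [AddCommGroup N]
    [Module K N] {π : A →ₗ[K] B} (hπ : Function.Surjective π) {φ : A ⊗[K] M →ₗ[K] N}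
    (hφ : ∀ a, π a = 0 → ∀ m, φ (a ⊗ₜ m) = 0) {z : A ⊗[K] M} (hz : π.rTensor M z = 0) :
    φ z = 0 := by
  obtain ⟨y, rfl⟩ := (rTensor_exact M (LinearMap.exact_subtype_ker_map π) hπ z).1 hz
  have h : φ ∘ₗ (LinearMap.ker π).subtype.rTensor M = 0 :=
    TensorProduct.ext' fun a m => hφ a a.2 m
  exact LinearMap.congr_fun h y

section LieAlgebra

variable {K : Type*} [CommRing K]

theorem exists_lieModule_of_surjective {L L' V : Type*} [LieRing L] [LieAlgebra K L] [LieRing L']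
    [LieAlgebra K L'] [AddCommGroup V] [Module K V] [LieRingModule L V] [LieModule K L V]
    {π : L →ₗ⁅K⁆ L'} (hπ : Function.Surjective π) (hker : ∀ x, π x = 0 → ∀ v : V, ⁅x, v⁆ = 0) :
    ∃ (_ : LieRingModule L' V) (_ : LieModule K L' V), ∀ (x : L) (v : V), ⁅π x, v⁆ = ⁅x, v⁆ := by
  have hσ (x : L) (v : V) : ⁅Function.surjInv hπ (π x), v⁆ = ⁅x, v⁆ := by
    rw [← sub_eq_zero, ← sub_lie]
    exact hker _ (by rw [map_sub, Function.surjInv_eq hπ, sub_self]) v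
  let act : LieRingModule L' V :=
    { bracket := fun y v => ⁅Function.surjInv hπ y, v⁆
      add_lie := hπ.forall₂.2 fun x y v => by
        simp only [← map_add, hσ, add_lie]
      lie_add := fun y => lie_add _
      leibniz_lie := hπ.forall₂.2 fun x y v => by
        simp only [← LieHom.map_lie, hσ, leibniz_lie x y] }
  exact ⟨act,
    { smul_lie := fun c => hπ.forall.2 fun x v => by
        change ⁅Function.surjInv hπ (c • π x), v⁆ = c • ⁅Function.surjInv hπ (π x), v⁆
        rw [← map_smul, hσ, hσ, smul_lie]
      lie_smul := fun c y => lie_smul c (Function.surjInv hπ y) }, hσ⟩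

theorem exists_lieModule_of_lieEquiv {L L' V : Type*} [LieRing L] [LieAlgebra K L] [LieRing L']
    [LieAlgebra K L'] [AddCommGroup V] [Module K V] [LieRingModule L V] [LieModule K L V]
    (Φ : L ≃ₗ⁅K⁆ L') :
    ∃ (_ : LieRingModule L' V) (_ : LieModule K L' V), ∀ (x : L) (v : V), ⁅Φ x, v⁆ = ⁅x, v⁆ :=
  exists_lieModule_of_surjective (π := Φ.toLieHom) Φ.surjective fun x hx v => by
    rw [(map_eq_zero_iff Φ Φ.injective).1 hx, zero_lie]

variable {N N' L : Type*} [LieRing N] [LieAlgebra K N] [LieRing N'] [LieAlgebra K N'] [LieRing L]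
  [LieAlgebra K L] {δ : L →ₗ⁅K⁆ LieDerivation K N N} {δ' : L →ₗ⁅K⁆ LieDerivation K N' N'}

/-- The homomorphism of semidirect sums `N ⋊ L → N' ⋊ L` induced by an `L`-equivariant
homomorphism `N → N'` and the identity of `L`. -/
def semiDirectSumMap (φ : N →ₗ⁅K⁆ N') (hφ : ∀ t x, φ (δ t x) = δ' t (φ x)) :
    LieAlgebra.SemiDirectSum N L δ →ₗ⁅K⁆ LieAlgebra.SemiDirectSum N' L δ' where
  toFun z := ⟨φ z.left, z.right⟩
  map_add' _ _ := LieAlgebra.SemiDirectSum.ext (map_add φ _ _) rfl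
  map_smul' c _ := LieAlgebra.SemiDirectSum.ext (map_smul φ c _) rfl
  map_lie' {_ _} := LieAlgebra.SemiDirectSum.ext (by simp [hφ]) (by simp)

/-- The isomorphism of semidirect sums `N ⋊ L ≃ N' ⋊ L` induced by an `L`-equivariant
isomorphism `N ≃ N'` and the identity of `L`. -/
def semiDirectSumCongr (φ : N ≃ₗ⁅K⁆ N') (hφ : ∀ t x, φ (δ t x) = δ' t (φ x)) :
    LieAlgebra.SemiDirectSum N L δ ≃ₗ⁅K⁆ LieAlgebra.SemiDirectSum N' L δ' where
  __ := semiDirectSumMap (φ : N →ₗ⁅K⁆ N') hφ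
  invFun z := ⟨φ.symm z.left, z.right⟩
  left_inv _ := LieAlgebra.SemiDirectSum.ext (φ.symm_apply_apply _) rfl
  right_inv _ := LieAlgebra.SemiDirectSum.ext (φ.apply_symm_apply _) rfl

end LieAlgebra

section TensorPi

variable {B L : Type*} [CommRing B] [Algebra ℂ B] [LieRing L] [LieAlgebra ℂ L] {k : ℕ}

/-- The isomorphism `B ⊗ L ≃ L^k` induced by an algebra isomorphism `B ≃ ℂ^k`. -/
def tensorLieEquivPi (E : B ≃ₐ[ℂ] (Fin k → ℂ)) : B ⊗[ℂ] L ≃ₗ⁅ℂ⁆ (Fin k → L) where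
  __ := (TensorProduct.congr E.toLinearEquiv (LinearEquiv.refl ℂ L)).trans
    ((TensorProduct.comm ℂ _ _).trans (TensorProduct.piScalarRight ℂ ℂ L (Fin k)))
  map_lie' {y z} := by
    induction y using TensorProduct.induction_on with
    | zero => simp
    | add y₁ y₂ h₁ h₂ => simp_all [add_lie]
    | tmul a x =>
      induction z using TensorProduct.induction_on with
      | zero => simp
      | add z₁ z₂ h₁ h₂ => simp_all [lie_add]
      | tmul b y =>
        ext i
        change _ = ⁅_, _⁆
        simp [smul_smul, mul_comm]

theorem tensorLieEquivPi_tmul (E : B ≃ₐ[ℂ] (Fin k → ℂ)) (b : B) (x : L) :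
    tensorLieEquivPi E (b ⊗ₜ x) = fun i => E b i • x :=
  funext fun i => by
    change TensorProduct.piScalarRight ℂ ℂ L (Fin k) (x ⊗ₜ E b) i = _
    simp

end TensorPi

namespace Realization

variable {ι : Type*} [Fintype ι] {C : Matrix ι ι ℤ} {H : Type*} [AddCommGroup H] [Module ℂ H]
  {R : Realization C H} {S : Submodule ℂ H} {A B : Type*} [CommRing A] [Algebra ℂ A] [CommRing B]
  [Algebra ℂ B]

variable (R S) in
/-- The homomorphism `g_A → g_B` induced by an algebra homomorphism `A → B`. -/
def currentMap (π : A →ₐ[ℂ] B) : R.Current S A →ₗ⁅ℂ⁆ R.Current S B :=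
  semiDirectSumMap (LieAlgebra.ExtendScalars.map π LieHom.id) fun t z => by
    induction z using TensorProduct.induction_on with
    | zero => simp only [map_zero]
    | add z₁ z₂ h₁ h₂ => simp only [map_add, h₁, h₂]
    | tmul a x => rfl

theorem exists_lieModule_current {V : Type*} [AddCommGroup V] [Module ℂ V]
    [LieRingModule (R.Current S A) V] [LieModule ℂ (R.Current S A) V] {π : A →ₐ[ℂ] B}
    (hπ : Function.Surjective π) (hker : ∀ a, π a = 0 → ∀ x, R.currentAct S V a x = 0) :
    ∃ (_ : LieRingModule (R.Current S B) V) (_ : LieModule ℂ (R.Current S B) V),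
      ∀ (a : A) (x : R.derived) (t : S) (v : V),
        ⁅Current.mk R S (π a ⊗ₜ[ℂ] x) t, v⁆ = ⁅Current.mk R S (a ⊗ₜ[ℂ] x) t, v⁆ := by
  suffices h : ∃ (_ : LieRingModule (R.Current S B) V) (_ : LieModule ℂ (R.Current S B) V),
      ∀ (z : R.Current S A) (v : V), ⁅R.currentMap S π z, v⁆ = ⁅z, v⁆ from
    h.imp fun _ => .imp fun _ h a x t => h (Current.mk R S (a ⊗ₜ x) t)
  refine exists_lieModule_of_surjective (fun ⟨z, t⟩ => ?_) fun ⟨z, t⟩ hz v => ?_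
  · obtain ⟨y, rfl⟩ := LinearMap.rTensor_surjective (g := π.toLinearMap) R.derived hπ z
    exact ⟨⟨y, t⟩, rfl⟩
  · obtain ⟨hz, ht⟩ := LieAlgebra.SemiDirectSum.ext_iff.1 hz
    obtain rfl : t = 0 := ht
    let φ : A ⊗[ℂ] R.derived →ₗ[ℂ] Module.End ℂ V :=
      (LieModule.toEnd ℂ (R.Current S A) V : R.Current S A →ₗ[ℂ] Module.End ℂ V) ∘ₗ
        (LieAlgebra.SemiDirectSum.inl (R.complAct S A) : A ⊗[ℂ] R.derived →ₗ[ℂ] R.Current S A)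
    exact LinearMap.congr_fun (apply_eq_zero_of_rTensor_eq_zero (π := π.toLinearMap) hπ
      (φ := φ) hker hz) v

/-- The isomorphism of `g_B` with the semidirect sum of `k` copies of `g'` and `h''` induced by an
algebra isomorphism `B ≃ ℂ^k`. -/
def currentEquivCopies {k : ℕ} (E : B ≃ₐ[ℂ] (Fin k → ℂ)) : R.Current S B ≃ₗ⁅ℂ⁆ R.Copies S k :=
  semiDirectSumCongr (tensorLieEquivPi E) fun t z => by
    induction z using TensorProduct.induction_on with
    | zero => simp only [map_zero]
    | add z₁ z₂ h₁ h₂ => simp only [map_add, h₁, h₂]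
    | tmul b x =>
      refine (tensorLieEquivPi_tmul E b _).trans ?_
      rw [tensorLieEquivPi_tmul]
      exact funext fun i => (map_smul (R.adCartan _) (E b i) x).symm

theorem currentEquivCopies_mk {k : ℕ} (E : B ≃ₐ[ℂ] (Fin k → ℂ)) (b : B) (x : R.derived) (t : S) :
    currentEquivCopies E (Current.mk R S (b ⊗ₜ[ℂ] x) t) = Copies.mk R S (fun i => E b i • x) t :=
  LieAlgebra.SemiDirectSum.ext (tensorLieEquivPi_tmul E b x) rfl

end Realization

end

end KacMoody

open scoped TensorProduct in
open KacMoody Realization in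
theorem theorem3p3_general {ι : Type*} [Fintype ι] {C : Matrix ι ι ℤ}
    {H : Type*} [AddCommGroup H] [Module ℂ H]
    (R : Realization C H)
    (S : Submodule ℂ H) (hS : IsCompl R.cartan' S)
    {A : Type*} [CommRing A] [Algebra ℂ A]
    {V : Type*} [AddCommGroup V] [Module ℂ V]
    [LieRingModule (R.Current S A) V] [LieModule ℂ (R.Current S A) V]
    [LieModule.IsIrreducible ℂ (R.Current S A) V]
    (ψ : (A ⊗[ℂ] R.cartan') × S →ₗ[ℂ] ℂ)
    (hψ : R.IsHighestWeight S A V ψ)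
    (hnil : ∀ (i : ι) (a : A) (w : V), ∃ k : ℕ,
      ((LieModule.toEnd ℂ (R.Current S A) V
        (Current.mk R S (a ⊗ₜ[ℂ] R.f i) 0)) ^ k) w = 0)
    (hfin : R.HasFiniteWeightSpaces S A V) :
    (∃ I : Ideal A, IsCofinite I ∧
      ∀ a ∈ I, ∀ t : R.cartan', ψ (a ⊗ₜ[ℂ] t, 0) = 0) ∧
    ∀ I J : Ideal A, IsCofinite I →
      (∀ a ∈ I, ∀ t : R.cartan', ψ (a ⊗ₜ[ℂ] t, 0) = 0) →
      J = I.radical →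
      J.IsRadical ∧ IsCofinite J ∧
      (∀ a ∈ J, ∀ (x : R.derived) (v : V),
        ⁅Current.mk R S (a ⊗ₜ[ℂ] x) 0, v⁆ = 0) ∧
      (∃ (_ : LieRingModule (R.Current S (A ⧸ J)) V) (_ : LieModule ℂ (R.Current S (A ⧸ J)) V),
        ∀ (a : A) (x : R.derived) (t : S) (v : V),
          ⁅Current.mk R S (Ideal.Quotient.mk J a ⊗ₜ[ℂ] x) t, v⁆ =
            ⁅Current.mk R S (a ⊗ₜ[ℂ] x) t, v⁆) ∧
      ∃ (k : ℕ) (χ : Fin k → A →ₐ[ℂ] ℂ),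
        Function.Injective χ ∧ J = ⨅ i, RingHom.ker (χ i) ∧
        (∃ Φ : R.Current S (A ⧸ J) ≃ₗ⁅ℂ⁆ R.Copies S k,
          ∀ (a : A) (x : R.derived) (t : S),
            Φ (Current.mk R S (Ideal.Quotient.mk J a ⊗ₜ[ℂ] x) t) =
              Copies.mk R S (fun i => χ i a • x) t) ∧
        ∃ (_ : LieRingModule (R.Copies S k) V) (_ : LieModule ℂ (R.Copies S k) V),
          ∀ (a : A) (x : R.derived) (t : S) (v : V),
            ⁅Copies.mk R S (fun i => χ i a • x) t, v⁆ =
              ⁅Current.mk R S (a ⊗ₜ[ℂ] x) t, v⁆ := by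
  obtain ⟨v, hv⟩ := hψ.exists_isHighestWeightVector
  refine ⟨⟨weightIdeal ψ, hv.isCofinite_weightIdeal hS hfin,
    fun a ha => apply_tmul_eq_zero ha⟩, ?_⟩
  rintro I J hI hψI rfl
  have hrad : I.radical ≤ weightIdeal ψ :=
    (hv.isRadical_weightIdeal hS.codisjoint fun i a => hnil i a v).radical_le_iff.2
      (le_vanishingIdeal hψI)
  have hzero (a) (ha : a ∈ I.radical) (x : R.derived) : R.currentAct S V a x = 0 :=
    hv.currentAct_eq_zero hS.codisjoint (hrad ha) x
  have hJ : IsCofinite I.radical := hI.mono Ideal.le_radical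
  obtain ⟨i₁, i₂, hquot⟩ := exists_lieModule_current (R := R) (S := S) (V := V)
    (π := Ideal.Quotient.mkₐ ℂ I.radical) Ideal.Quotient.mk_surjective fun a ha =>
      hzero a (Ideal.Quotient.eq_zero_iff_mem.1 ha)
  obtain ⟨k, χ, E, hχ, hker, hE⟩ := hJ.exists_characters I.radical_isRadical
  let Φ : R.Current S (A ⧸ I.radical) ≃ₗ⁅ℂ⁆ R.Copies S k := currentEquivCopies E
  have hΦ (a : A) (x : R.derived) (t : S) :
      Φ (Current.mk R S (Ideal.Quotient.mk I.radical a ⊗ₜ x) t) =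
        Copies.mk R S (fun i => χ i a • x) t := by
    rw [currentEquivCopies_mk, hE]
  obtain ⟨j₁, j₂, hcopies⟩ := exists_lieModule_of_lieEquiv (V := V) Φ
  refine ⟨I.radical_isRadical, hJ, fun a ha x => LinearMap.congr_fun (hzero a ha x),
    ⟨i₁, i₂, hquot⟩, k, χ, hχ, hker, ⟨Φ, hΦ⟩, j₁, j₂, fun a x t w => ?_⟩
  rw [← hΦ, hcopies]
  exact hquot a x t w

open scoped TensorProduct in
theorem theorem3p3 {ι : Type*} [Fintype ι] {C : Matrix ι ι ℤ}
    {H : Type*} [AddCommGroup H] [Module ℂ H]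
    (R : KacMoody.Realization C H)
    (S : Submodule ℂ H) (hS : IsCompl R.cartan' S)
    {A : Type*} [CommRing A] [Algebra ℂ A] [Algebra.FiniteType ℂ A]
    {V : Type*} [AddCommGroup V] [Module ℂ V]
    [LieRingModule (R.Current S A) V] [LieModule ℂ (R.Current S A) V]
    [LieModule.IsIrreducible ℂ (R.Current S A) V]
    (ψ : (A ⊗[ℂ] R.cartan') × S →ₗ[ℂ] ℂ)
    (hψ : R.IsHighestWeight S A V ψ)
    (hint : R.IsIntegrable S A V)
    (hfin : R.HasFiniteWeightSpaces S A V) :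
    (∃ I : Ideal A, KacMoody.IsCofinite I ∧
      ∀ a ∈ I, ∀ t : R.cartan', ψ (a ⊗ₜ[ℂ] t, 0) = 0) ∧
    ∀ I J : Ideal A, KacMoody.IsCofinite I →
      (∀ a ∈ I, ∀ t : R.cartan', ψ (a ⊗ₜ[ℂ] t, 0) = 0) →
      J = I.radical →
      J.IsRadical ∧ KacMoody.IsCofinite J ∧
      (∀ a ∈ J, ∀ (x : R.derived) (v : V),
        ⁅KacMoody.Realization.Current.mk R S (a ⊗ₜ[ℂ] x) 0, v⁆ = 0) ∧
      (∃ (_ : LieRingModule (R.Current S (A ⧸ J)) V) (_ : LieModule ℂ (R.Current S (A ⧸ J)) V),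
        ∀ (a : A) (x : R.derived) (t : S) (v : V),
          ⁅KacMoody.Realization.Current.mk R S (Ideal.Quotient.mk J a ⊗ₜ[ℂ] x) t, v⁆ =
            ⁅KacMoody.Realization.Current.mk R S (a ⊗ₜ[ℂ] x) t, v⁆) ∧
      ∃ (k : ℕ) (χ : Fin k → A →ₐ[ℂ] ℂ),
        Function.Injective χ ∧ J = ⨅ i, RingHom.ker (χ i) ∧
        (∃ Φ : R.Current S (A ⧸ J) ≃ₗ⁅ℂ⁆ R.Copies S k,
          ∀ (a : A) (x : R.derived) (t : S),
            Φ (KacMoody.Realization.Current.mk R S (Ideal.Quotient.mk J a ⊗ₜ[ℂ] x) t) =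
              KacMoody.Realization.Copies.mk R S (fun i => χ i a • x) t) ∧
        ∃ (_ : LieRingModule (R.Copies S k) V) (_ : LieModule ℂ (R.Copies S k) V),
          ∀ (a : A) (x : R.derived) (t : S) (v : V),
            ⁅KacMoody.Realization.Copies.mk R S (fun i => χ i a • x) t, v⁆ =
              ⁅KacMoody.Realization.Current.mk R S (a ⊗ₜ[ℂ] x) t, v⁆ :=
  theorem3p3_general R S hS ψ hψ (fun i a => hint.2 _ (R.isRealRoot_neg_root i) (R.f i)
    (R.f_mem_rootSpace i) a) hfin
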